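/- For a finite set $X\subset\mathbb R^2$ let $[X]$ be its convex hull, and let $b_X$ and $i_X$ be the numbers of points of $X$ on the boundary and in the interior of $[X]$, respectively. A triangulation of $X$ is a simplicial complex whose vertex set is exactly $X$ and whose underlying space is $[X]$. Let $A$ and $B$ be finite non-collinear sets in $\mathbb R^2$ all of whose points lie on the boundaries of their convex hulls, that is, $|A|=b_A$ and $|B|=b_B$. Then: (1) If the inequality $2i_{A+B}\ge b_A+b_B-6$ fails, then either $|A|=3$ and $B$ is a translate of $A+A$, or $|B|=3$ and $A$ is a translate of $B+B$. (2) In all cases $$\sqrt{2i_{A+B}+b_{A+B}-2}\;\ge\;\sqrt{2i_A+b_A-2}+\sqrt{2i_B+b_B-2}.$$ (3) Equivalently, $\sqrt{\mathrm{tr}(A+B)}\ge\sqrt{\mathrm{tr}(A)}+\sqrt{\mathrm{tr}(B)}$, where $\mathrm{tr}(X)$ is the common number of triangles of all triangulations of $X$; that is, for any triangulations of $A$, $B$ and $A+B$ with $t_A$, $t_B$ and $t_{A+B}$ triangles, $\sqrt{t_{A+B}}\ge\sqrt{t_A}+\sqrt{t_B}$. -/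

import Mathlib

open scoped Pointwise

/-- The Euclidean plane. -/
abbrev Plane : Type := EuclideanSpace ℝ (Fin 2)

/-- `b_A`: the number of points of `A` on the boundary of its convex hull. -/
noncomputable def boundaryCount (A : Set Plane) : ℕ :=
  (A ∩ frontier (convexHull ℝ A)).ncard

/-- `i_A`: the number of points of `A` in the interior of its convex hull. -/
noncomputable def interiorCount (A : Set Plane) : ℕ :=
  (A ∩ interior (convexHull ℝ A)).ncard

/-- `K` is a triangulation of the convex hull of `A` whose vertices are exactly the points
of `A`. -/
def IsTriangulation (A : Set Plane) (K : Geometry.SimplicialComplex ℝ Plane) : Prop :=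
  K.vertices = A ∧ K.space = convexHull ℝ A

/-- The number of triangles (two-dimensional faces) of `K`. -/
noncomputable def triangleCount (K : Geometry.SimplicialComplex ℝ Plane) : ℕ :=
  {s : Finset Plane | s ∈ K.faces ∧ s.card = 3}.ncard

/-! Convexity is encoded by linear functionals: a point of a non-collinear set `X` is on the
boundary exactly when some nonzero functional attains its maximum over `X` there. A sum `a + b`
maximizes `w` over `A + B` iff `a` and `b` maximize `w` over `A` and `B`, so `a + b` is interior as
soon as `a` and `b` share no nonzero supporting functional.

Three facts give the square root inequality. First, `b_{A+B} ≥ b_A + b_B` (`boundaryCount_add_le`),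
edge by edge. Second, `2 i_{A+B} ≥ b_A + b_B - 6` outside the exceptional pairs
(`many_interior_or_exceptional`). Together they give `2 i_{A+B} + b_{A+B} - 2 ≥ 2 ((b_A - 2) + (b_B
- 2))`, which suffices because `(√x + √y)² ≤ 2 (x + y)`. Third, in an exceptional pair the left side
is at least 9, and `√9 = √1 + √4`.

For the second fact with at least four points in each set, a generic direction cuts each boundary
into a highest point, a lowest point and two chains. Opposite chains of `A` and `B` share no
functional, so their sum is interior; projection to the line shows that it has at least the sum of
their sizes minus one elements. One of the two pairings carries at least half of the `b_A + b_B - 4`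
chain points. When `A` is a triangle, each side yields translates of pieces of `B` inside the
interior (`levels_of_few_interior`); too few interior points force equality in every estimate, for
all three sides, and this determines `B`.

The triangle count `2 i + b - 2` (`triangleCount_add_two`) comes from a bijection. For a generic
height function each triangle has a middle vertex, from which exactly one of the two horizontal rays
enters it. Conversely, every horizontal ray from a point of `X` that enters the hull starts in
exactly one triangle. Interior points have two such rays, boundary points one, the highest and
lowest points none. -/

/-! ### Linear functionals on the plane and the faces they expose -/

/-- The linear functional on the plane represented by the vector `w`. -/
def lin (w x : Plane) : ℝ := w 0 * x 0 + w 1 * x 1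

/-- Counterclockwise rotation by a right angle. -/
def rot (w : Plane) : Plane := !₂[-(w 1), w 0]

@[simp] lemma rot_zero_apply (w : Plane) : rot w 0 = -(w 1) := rfl
@[simp] lemma rot_one_apply (w : Plane) : rot w 1 = w 0 := rfl

lemma lin_add (w x y : Plane) : lin w (x + y) = lin w x + lin w y := by
  simp [lin]; ring

lemma lin_sub (w x y : Plane) : lin w (x - y) = lin w x - lin w y := by
  simp [lin]; ring

lemma lin_smul (w : Plane) (c : ℝ) (x : Plane) : lin w (c • x) = c * lin w x := by
  simp [lin]; ring

lemma add_lin (v w x : Plane) : lin (v + w) x = lin v x + lin w x := by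
  simp [lin]; ring

lemma smul_lin (w : Plane) (c : ℝ) (x : Plane) : lin (c • w) x = c * lin w x := by
  simp [lin]; ring

lemma neg_lin (w x : Plane) : lin (-w) x = -lin w x := by
  simp [lin]; ring

lemma zero_lin (x : Plane) : lin 0 x = 0 := by
  simp [lin]

lemma lin_rot (v w : Plane) : lin v (rot w) = -lin w (rot v) := by
  simp [lin]; ring

lemma rot_neg (w : Plane) : rot (-w) = -rot w := by
  ext i; fin_cases i <;> simp

lemma lin_rot_neg (v w : Plane) : lin v (rot (-w)) = -lin v (rot w) := by
  simp [lin]; ring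

lemma lin_rot_self (w : Plane) : lin w (rot w) = 0 := by
  simp [lin]; ring

lemma lin_self_pos {w : Plane} (hw : w ≠ 0) : 0 < lin w w := by
  by_contra h
  apply hw
  have h0 : w 0 = 0 := by simp only [lin] at h; nlinarith [sq_nonneg (w 0), sq_nonneg (w 1)]
  have h1 : w 1 = 0 := by simp only [lin] at h; nlinarith [sq_nonneg (w 0), sq_nonneg (w 1)]
  ext i; fin_cases i <;> simp [h0, h1]

lemma rot_ne_zero {w : Plane} (hw : w ≠ 0) : rot w ≠ 0 := by
  intro h
  have h1 := lin_self_pos hw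
  have h2 : lin (rot w) (rot w) = 0 := by rw [h, zero_lin]
  simp [lin] at h1 h2; linarith

lemma continuous_lin (w : Plane) : Continuous (lin w) := by
  unfold lin; fun_prop

/-- A vector annihilated by `w ≠ 0` is a multiple of `rot w`. -/
lemma exists_smul_rot {w x : Plane} (hw : w ≠ 0) (h : lin w x = 0) : ∃ c : ℝ, x = c • rot w := by
  have hne := (lin_self_pos hw).ne'
  obtain ⟨c, hc⟩ : ∃ c, c * lin w w = lin (rot w) x := ⟨_, div_mul_cancel₀ _ hne⟩
  refine ⟨c, ?_⟩
  simp only [lin, rot_zero_apply, rot_one_apply] at *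
  ext i
  apply mul_left_cancel₀ hne
  fin_cases i
  · simp [-mul_eq_mul_left_iff]; linear_combination (w 0) * h + (w 1) * hc
  · simp [-mul_eq_mul_left_iff]; linear_combination (w 1) * h - (w 0) * hc

lemma exists_smul_of_lin_rot_eq_zero {f h : Plane} (hh : h ≠ 0) (hf : lin f (rot h) = 0) :
    ∃ c : ℝ, f = c • h := by
  have hne := (lin_self_pos hh).ne'
  obtain ⟨c, hc⟩ : ∃ c, c * lin h h = lin f h := ⟨_, div_mul_cancel₀ _ hne⟩
  refine ⟨c, ?_⟩
  simp only [lin, rot_zero_apply, rot_one_apply] at *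
  ext i
  apply mul_left_cancel₀ hne
  fin_cases i
  · simp [-mul_eq_mul_left_iff]; linear_combination (-(h 1)) * hf - (h 0) * hc
  · simp [-mul_eq_mul_left_iff]; linear_combination (h 0) * hf - (h 1) * hc

/-- Two functionals that are not proportional separate points. -/
lemma eq_of_lin_eq {f g x y : Plane} (hfg : lin f (rot g) ≠ 0) (hf : lin f x = lin f y)
    (hg : lin g x = lin g y) : x = y := by
  simp only [lin, rot_zero_apply, rot_one_apply] at *
  ext i
  fin_cases i
  · simp only [Fin.zero_eta]
    apply mul_left_cancel₀ hfg
    linear_combination -(g 1) * hf + (f 1) * hg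
  · simp only [Fin.mk_one]
    apply mul_left_cancel₀ hfg
    linear_combination (g 0) * hf - (f 0) * hg

lemma collinear_iff_lin {X : Set Plane} :
    Collinear ℝ X ↔ ∃ w : Plane, w ≠ 0 ∧ ∃ c, ∀ x ∈ X, lin w x = c := by
  have h1 : (!₂[1, 0] : Plane) ≠ 0 := fun h => by
    have := congrArg (fun v : Plane => v 0) h; simp at this
  rcases X.eq_empty_or_nonempty with rfl | ⟨p, hp⟩
  · exact ⟨fun _ => ⟨_, h1, 0, by simp⟩, fun _ => collinear_empty ℝ Plane⟩
  rw [collinear_iff_of_mem hp]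
  constructor
  · rintro ⟨v, hv⟩
    by_cases h0 : v = 0
    · refine ⟨_, h1, lin !₂[1, 0] p, fun x hx => ?_⟩
      obtain ⟨r, rfl⟩ := hv x hx
      simp [h0]
    · refine ⟨rot v, rot_ne_zero h0, lin (rot v) p, fun x hx => ?_⟩
      obtain ⟨r, rfl⟩ := hv x hx
      rw [vadd_eq_add, lin_add, lin_smul]
      simp [lin]; ring_nf; simp
  · rintro ⟨w, hw, c, hc⟩
    refine ⟨rot w, fun x hx => ?_⟩
    obtain ⟨r, hr⟩ := exists_smul_rot (x := x - p) hw (by rw [lin_sub, hc x hx, hc p hp, sub_self])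
    exact ⟨r, by rw [vadd_eq_add, ← hr, sub_add_cancel]⟩

/-- The points of `X` at which the functional `w` attains its maximum over `X`. -/
def face (X : Set Plane) (w : Plane) : Set Plane := {x | x ∈ X ∧ ∀ y ∈ X, lin w y ≤ lin w x}

lemma face_subset (X : Set Plane) (w : Plane) : face X w ⊆ X := fun _ h => h.1

lemma face_nonempty {X : Set Plane} (hX : X.Finite) (hne : X.Nonempty) (w : Plane) :
    (face X w).Nonempty := by
  obtain ⟨x, hx, h⟩ := Set.exists_max_image X (lin w) hX hne
  exact ⟨x, hx, h⟩

lemma lin_eq_of_mem_face {X : Set Plane} {w x y : Plane} (hx : x ∈ face X w) (hy : y ∈ face X w) :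
    lin w x = lin w y := le_antisymm (hy.2 x hx.1) (hx.2 y hy.1)

lemma mem_face_smul {X : Set Plane} {w x : Plane} {c : ℝ} (hc : 0 < c) :
    x ∈ face X (c • w) ↔ x ∈ face X w := by
  simp only [face, Set.mem_ofPred_eq, smul_lin, mul_le_mul_iff_right₀ hc]

lemma add_mem_face {A B : Set Plane} {w a b : Plane} (ha : a ∈ A) (hb : b ∈ B) :
    a + b ∈ face (A + B) w ↔ a ∈ face A w ∧ b ∈ face B w := by
  constructor
  · rintro ⟨-, h⟩
    refine ⟨⟨ha, fun y hy => ?_⟩, ⟨hb, fun y hy => ?_⟩⟩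
    · have := h _ (Set.add_mem_add hy hb); simp only [lin_add] at this; linarith
    · have := h _ (Set.add_mem_add ha hy); simp only [lin_add] at this; linarith
  · rintro ⟨h1, h2⟩
    refine ⟨Set.add_mem_add ha hb, ?_⟩
    rintro _ ⟨x, hx, y, hy, rfl⟩
    simp only [lin_add]
    exact add_le_add (h1.2 x hx) (h2.2 y hy)

lemma face_add (A B : Set Plane) (w : Plane) : face (A + B) w = face A w + face B w := by
  ext x
  constructor
  · intro h
    obtain ⟨a, ha, b, hb, rfl⟩ := h.1
    obtain ⟨h1, h2⟩ := (add_mem_face ha hb).1 h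
    exact Set.add_mem_add h1 h2
  · rintro ⟨a, ha, b, hb, rfl⟩
    exact (add_mem_face ha.1 hb.1).2 ⟨ha, hb⟩

/-- If `h` and `-h` expose a common point then `h` is constant. -/
lemma face_disjoint_face_neg {X : Set Plane} (hX : ¬ Collinear ℝ X) {w x : Plane} (hw : w ≠ 0)
    (h1 : x ∈ face X w) (h2 : x ∈ face X (-w)) : False := by
  refine hX (collinear_iff_lin.2 ⟨w, hw, lin w x, fun y hy => le_antisymm (h1.2 y hy) ?_⟩)
  have := h2.2 y hy
  simp only [neg_lin] at this
  linarith

lemma nonempty_of_not_collinear {X : Set Plane} (hX : ¬ Collinear ℝ X) : X.Nonempty := by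
  rw [Set.nonempty_iff_ne_empty]
  rintro rfl
  exact hX (collinear_empty ℝ Plane)

lemma not_collinear_add {A B : Set Plane} (hA : ¬ Collinear ℝ A) (hB : B.Nonempty) :
    ¬ Collinear ℝ (A + B) := by
  obtain ⟨b, hb⟩ := hB
  intro h
  obtain ⟨w, hw, c, hc⟩ := collinear_iff_lin.1 h
  refine hA (collinear_iff_lin.2 ⟨w, hw, c - lin w b, fun a ha => ?_⟩)
  have := hc _ (Set.add_mem_add ha hb)
  rw [lin_add] at this
  linarith

lemma exists_lin_lt {X : Set Plane} (hX : ¬ Collinear ℝ X) {w x : Plane} (hw : w ≠ 0)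
    (hx : x ∈ face X w) : ∃ y ∈ X, lin w y < lin w x := by
  by_contra! h
  exact hX (collinear_iff_lin.2 ⟨w, hw, lin w x, fun y hy => le_antisymm (hx.2 y hy) (h y hy)⟩)

/-! ### Interior and boundary points in terms of supporting functionals -/

lemma lin_le_of_mem_convexHull {X : Set Plane} {w : Plane} {c : ℝ} (h : ∀ y ∈ X, lin w y ≤ c)
    {z : Plane} (hz : z ∈ convexHull ℝ X) : lin w z ≤ c := by
  have hconv : Convex ℝ {y : Plane | lin w y ≤ c} :=
    convex_halfSpace_le ⟨lin_add w, fun c x => lin_smul w c x⟩ c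
  exact convexHull_min h hconv hz

lemma exists_lin_eq (f : StrongDual ℝ Plane) : ∃ w : Plane, ∀ x, f x = lin w x := by
  refine ⟨!₂[f !₂[1, 0], f !₂[0, 1]], fun x => ?_⟩
  have hx : x = x 0 • (!₂[1, 0] : Plane) + x 1 • (!₂[0, 1] : Plane) := by
    ext i; fin_cases i <;> simp
  conv_lhs => rw [hx, map_add, map_smul, map_smul]
  simp [lin]; ring

lemma affineSpan_eq_top_of_not_collinear {X : Set Plane} (hX : ¬ Collinear ℝ X) :
    affineSpan ℝ X = ⊤ := by
  rw [AffineSubspace.affineSpan_eq_top_iff_vectorSpan_eq_top_of_nonempty ℝ Plane Plane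
    (nonempty_of_not_collinear hX)]
  rw [collinear_iff_finrank_le_one] at hX
  apply Submodule.eq_top_of_finrank_eq
  have h1 := Submodule.finrank_le (vectorSpan ℝ X)
  have h2 : Module.finrank ℝ Plane = 2 := by simp
  omega

/-- A small step from an interior point in direction `w` stays in the hull and increases `w`.
Conversely, Hahn–Banach separates a non-interior point from the open interior; the inequality passes
to the closure, which contains `X` because non-collinearity makes the interior nonempty. -/
lemma mem_interior_convexHull_iff {X : Set Plane} (hX : ¬ Collinear ℝ X) {p : Plane} (hp : p ∈ X) :
    p ∈ interior (convexHull ℝ X) ↔ ∀ w, w ≠ 0 → p ∉ face X w := by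
  constructor
  · intro h w hw hf
    have hcont : Filter.Tendsto (fun t : ℝ => p + t • w) (nhdsWithin 0 (Set.Ioi 0)) (nhds p) := by
      have : Continuous (fun t : ℝ => p + t • w) := by fun_prop
      have h2 := this.tendsto 0
      simp only [zero_smul, add_zero] at h2
      exact h2.mono_left nhdsWithin_le_nhds
    have hev := hcont.eventually (isOpen_interior.mem_nhds h)
    obtain ⟨t, ht, ht0⟩ := (hev.and self_mem_nhdsWithin).exists
    have := lin_le_of_mem_convexHull hf.2 (interior_subset ht)
    rw [lin_add, lin_smul] at this
    have := mul_pos ht0 (lin_self_pos hw)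
    linarith
  · intro h
    by_contra hn
    have hconv := convex_convexHull ℝ X
    obtain ⟨f, hf⟩ := geometric_hahn_banach_open_point hconv.interior isOpen_interior hn
    obtain ⟨w, hw⟩ := exists_lin_eq f
    have hne : (interior (convexHull ℝ X)).Nonempty :=
      interior_convexHull_nonempty_iff_affineSpan_eq_top.2 (affineSpan_eq_top_of_not_collinear hX)
    simp only [hw] at hf
    refine h w ?_ ⟨hp, fun y hy => ?_⟩
    · rintro rfl
      obtain ⟨z, hz⟩ := hne
      simpa [zero_lin] using hf z hz
    · have hy' : y ∈ closure (interior (convexHull ℝ X)) := by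
        rw [hconv.closure_interior_eq_closure_of_nonempty_interior hne]
        exact subset_closure (subset_convexHull ℝ X hy)
      have hcl : IsClosed {z : Plane | lin w z ≤ lin w p} :=
        isClosed_le (continuous_lin w) continuous_const
      exact closure_minimal (fun z hz => (hf z hz).le) hcl hy'

lemma mem_frontier_convexHull_iff {X : Set Plane} (hX : ¬ Collinear ℝ X) {p : Plane} (hp : p ∈ X) :
    p ∈ frontier (convexHull ℝ X) ↔ ∃ w, w ≠ 0 ∧ p ∈ face X w := by
  have h1 : p ∈ frontier (convexHull ℝ X) ↔ p ∉ interior (convexHull ℝ X) := by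
    rw [frontier, Set.mem_sdiff]
    exact and_iff_right (subset_closure (subset_convexHull ℝ X hp))
  rw [h1, mem_interior_convexHull_iff hX hp]
  push Not
  rfl

/-- A sum of two points is interior unless the summands share a supporting functional. -/
lemma add_mem_interior {A B : Set Plane} (hA : ¬ Collinear ℝ A) (hB : ¬ Collinear ℝ B)
    {a b : Plane} (ha : a ∈ A) (hb : b ∈ B)
    (h : ∀ w, w ≠ 0 → a ∈ face A w → b ∈ face B w → False) :
    a + b ∈ (A + B) ∩ interior (convexHull ℝ (A + B)) := by
  refine ⟨Set.add_mem_add ha hb, ?_⟩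
  rw [mem_interior_convexHull_iff (not_collinear_add hA (nonempty_of_not_collinear hB))
    (Set.add_mem_add ha hb)]
  intro w hw hf
  obtain ⟨h1, h2⟩ := (add_mem_face ha hb).1 hf
  exact h w hw h1 h2

/-! ### The two boundary chains determined by a direction -/

/-- The points of `X`, other than the highest and the lowest ones with respect to `h`, that
maximize some functional which is positive on `rot h`. -/
def chain (X : Set Plane) (h : Plane) : Set Plane :=
  {x | x ∈ X ∧ x ∉ face X h ∧ x ∉ face X (-h) ∧ ∃ f, x ∈ face X f ∧ 0 < lin f (rot h)}

lemma chain_subset (X : Set Plane) (h : Plane) : chain X h ⊆ X := fun _ hx => hx.1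

lemma mem_face_of_smul {X : Set Plane} {h x : Plane} {c : ℝ} (hc : c ≠ 0)
    (hx : x ∈ face X (c • h)) : x ∈ face X h ∨ x ∈ face X (-h) := by
  rcases lt_or_gt_of_ne hc with hc | hc
  · right
    rw [show c • h = (-c) • (-h) by simp, mem_face_smul (by linarith)] at hx
    exact hx
  · left
    exact (mem_face_smul hc).1 hx

lemma eq_zero_of_mid {X : Set Plane} {h x g : Plane} (hh : h ≠ 0) (h1 : x ∉ face X h)
    (h2 : x ∉ face X (-h)) (hg : x ∈ face X g) (h0 : lin g (rot h) = 0) : g = 0 := by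
  obtain ⟨c, rfl⟩ := exists_smul_of_lin_rot_eq_zero hh h0
  by_cases hc : c = 0
  · simp [hc]
  · rcases mem_face_of_smul hc hg with h | h
    · exact absurd h h1
    · exact absurd h h2

/-- The side of the boundary on which a chain point lies does not depend on the supporting
functional. If `f` and `g` had opposite signs on `rot h`, a combination with positive coefficients
would vanish on `rot h` and still be maximal at `x`, hence be zero. Then `g` is a negative multiple
of `f`, both are maximal at `x`, and `g` is constant on `X`. -/
lemma lin_rot_pos_of_mem_chain {X : Set Plane} (hX : ¬ Collinear ℝ X) {h x g : Plane} (hh : h ≠ 0)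
    (hx : x ∈ chain X h) (hg : x ∈ face X g) (hg0 : g ≠ 0) : 0 < lin g (rot h) := by
  obtain ⟨hxX, h1, h2, f, hf, hfp⟩ := hx
  by_contra! hle
  rcases hle.lt_or_eq with hlt | heq
  · have hk : lin f (rot h) • g + (-lin g (rot h)) • f = 0 := by
      refine eq_zero_of_mid hh h1 h2 ⟨hxX, fun y hy => ?_⟩ ?_
      · simp only [add_lin, smul_lin]
        have a1 := mul_le_mul_of_nonneg_left (hg.2 y hy) hfp.le
        have a2 := mul_le_mul_of_nonneg_left (hf.2 y hy) (neg_pos.2 hlt).le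
        linarith
      · simp only [add_lin, smul_lin]; ring
    refine hX (collinear_iff_lin.2 ⟨g, hg0, lin g x, fun y hy => ?_⟩)
    have e1 := congrArg (fun k => lin k (x - y)) hk
    simp only [add_lin, smul_lin, zero_lin, lin_sub] at e1
    have a1 := hg.2 y hy
    have a2 := mul_nonneg (neg_pos.2 hlt).le (sub_nonneg.2 (hf.2 y hy))
    by_contra hne
    have : lin g y < lin g x := lt_of_le_of_ne a1 hne
    have := mul_pos hfp (sub_pos.2 this)
    linarith
  · exact hg0 (eq_zero_of_mid hh h1 h2 hg heq)

lemma ne_zero_of_lin_ne_zero {f x : Plane} (h : lin f x ≠ 0) : f ≠ 0 := by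
  rintro rfl
  exact h (zero_lin x)

lemma disjoint_chain {X : Set Plane} (hX : ¬ Collinear ℝ X) {h : Plane} (hh : h ≠ 0) :
    Disjoint (chain X h) (chain X (-h)) := by
  rw [Set.disjoint_left]
  rintro x hx ⟨-, -, -, f, hf, hfp⟩
  rw [lin_rot_neg] at hfp
  have := lin_rot_pos_of_mem_chain hX hh hx hf (ne_zero_of_lin_ne_zero (by linarith : lin f (rot h) < 0).ne)
  linarith

/-- Of two points on one level, only the one further along `rot h` can maximize a functional
positive on `rot h`. -/
lemma injOn_lin_chain (X : Set Plane) {h : Plane} (hh : h ≠ 0) : Set.InjOn (lin h) (chain X h) := by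
  have key : ∀ x ∈ chain X h, ∀ y ∈ chain X h, ∀ c : ℝ, x - y = c • rot h → c ≤ 0 := by
    rintro x ⟨hx, -⟩ y ⟨-, -, -, f, hf, hfp⟩ c hc
    have h1 := hf.2 x hx
    have h2 := congrArg (lin f) hc
    rw [lin_sub, lin_smul] at h2
    by_contra! hc0
    have := mul_pos hc0 hfp
    linarith
  intro x hx y hy hxy
  obtain ⟨c, hc⟩ := exists_smul_rot (x := x - y) hh (by rw [lin_sub]; linarith)
  have h1 := key x hx y hy c hc
  have h2 := key y hy x hx (-c) (by rw [neg_smul, ← hc, neg_sub])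
  have : c = 0 := by linarith
  rw [this, zero_smul, sub_eq_zero] at hc
  exact hc

lemma injOn_lin_chain_neg (X : Set Plane) {h : Plane} (hh : h ≠ 0) :
    Set.InjOn (lin h) (chain X (-h)) := by
  intro x hx y hy hxy
  exact injOn_lin_chain X (neg_ne_zero.2 hh) hx hy (by simp only [neg_lin, hxy])

lemma mem_chain_or {X : Set Plane} {h x : Plane} (hh : h ≠ 0) (hx : x ∈ X)
    (hs : ∃ w, w ≠ 0 ∧ x ∈ face X w) (h1 : x ∉ face X h) (h2 : x ∉ face X (-h)) :
    x ∈ chain X h ∨ x ∈ chain X (-h) := by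
  obtain ⟨w, hw, hxw⟩ := hs
  rcases lt_trichotomy (lin w (rot h)) 0 with h0 | h0 | h0
  · exact Or.inr ⟨hx, h2, by rwa [neg_neg], w, hxw, by rw [lin_rot_neg]; linarith⟩
  · exact absurd (eq_zero_of_mid hh h1 h2 hxw h0) hw
  · exact Or.inl ⟨hx, h1, h2, w, hxw, h0⟩

/-- The two chains together with the extreme faces partition the boundary points of `X`. -/
lemma boundaryCount_eq_chain {X : Set Plane} (hX : ¬ Collinear ℝ X) (hfin : X.Finite)
    {h : Plane} (hh : h ≠ 0) : boundaryCount X =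
      (face X h).ncard + (face X (-h)).ncard + (chain X h).ncard + (chain X (-h)).ncard := by
  have f1 := hfin.subset (face_subset X h)
  have f2 := hfin.subset (face_subset X (-h))
  have f3 := hfin.subset (chain_subset X h)
  have f4 := hfin.subset (chain_subset X (-h))
  have hU : X ∩ frontier (convexHull ℝ X) = ((face X h ∪ face X (-h)) ∪ chain X h) ∪ chain X (-h) := by
    ext x
    constructor
    · rintro ⟨hx, hxf⟩
      by_cases h1 : x ∈ face X h
      · simp [h1]
      by_cases h2 : x ∈ face X (-h)
      · simp [h2]
      rcases mem_chain_or hh hx ((mem_frontier_convexHull_iff hX hx).1 hxf) h1 h2 with h | h <;> simp [h]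
    · have hf : ∀ w, w ≠ 0 → x ∈ face X w → x ∈ X ∩ frontier (convexHull ℝ X) := fun w hw hx =>
        ⟨hx.1, (mem_frontier_convexHull_iff hX hx.1).2 ⟨w, hw, hx⟩⟩
      rintro (((hx | hx) | ⟨-, -, -, f, hx, hfp⟩) | ⟨-, -, -, f, hx, hfp⟩)
      · exact hf h hh hx
      · exact hf (-h) (neg_ne_zero.2 hh) hx
      · exact hf f (ne_zero_of_lin_ne_zero hfp.ne') hx
      · exact hf f (ne_zero_of_lin_ne_zero hfp.ne') hx
  rw [boundaryCount, hU, Set.ncard_union_eq _ ((f1.union f2).union f3) f4, Set.ncard_union_eq _ (f1.union f2) f3,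
    Set.ncard_union_eq _ f1 f2]
  · rw [Set.disjoint_left]; exact fun x hx hx' => face_disjoint_face_neg hX hh hx hx'
  · rw [Set.disjoint_left]
    rintro x (hx | hx) hx'
    · exact hx'.2.1 hx
    · exact hx'.2.2.1 hx
  · rw [Set.disjoint_left]
    rintro x ((hx | hx) | hx) hx'
    · exact hx'.2.2.1 (by rwa [neg_neg])
    · exact hx'.2.1 hx
    · exact Set.disjoint_left.1 (disjoint_chain hX hh) hx hx'

lemma ncard_eq_boundaryCount {X : Set Plane} (hX : ¬ Collinear ℝ X)
    (hb : ∀ x ∈ X, ∃ w, w ≠ 0 ∧ x ∈ face X w) : X.ncard = boundaryCount X := by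
  rw [boundaryCount, Set.inter_eq_left.2]
  exact fun x hx => (mem_frontier_convexHull_iff hX hx).2 (hb x hx)

/-- After projection by `lin h` this is the Cauchy–Davenport bound for finite sets of reals. -/
lemma ncard_add_ge {P Q : Set Plane} {h : Plane} (hP : P.Finite) (hQ : Q.Finite)
    (hP0 : P.Nonempty) (hQ0 : Q.Nonempty) (hPi : Set.InjOn (lin h) P) (hQi : Set.InjOn (lin h) Q) :
    P.ncard + Q.ncard ≤ (P + Q).ncard + 1 := by
  classical
  lift P to Finset Plane using hP
  lift Q to Finset Plane using hQ
  have h1 := cauchy_davenport_add_of_linearOrder_isCancelAdd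
    (s := P.image (lin h)) (t := Q.image (lin h)) (by simpa using hP0) (by simpa using hQ0)
  rw [Finset.card_image_of_injOn hPi, Finset.card_image_of_injOn hQi] at h1
  have h2 : P.image (lin h) + Q.image (lin h) = (P + Q).image (lin h) := by
    ext r
    simp only [Finset.mem_add, Finset.mem_image]
    constructor
    · rintro ⟨_, ⟨a, ha, rfl⟩, _, ⟨b, hb, rfl⟩, rfl⟩
      exact ⟨a + b, ⟨a, ha, b, hb, rfl⟩, lin_add h a b⟩
    · rintro ⟨_, ⟨a, ha, b, hb, rfl⟩, rfl⟩
      exact ⟨_, ⟨a, ha, rfl⟩, _, ⟨b, hb, rfl⟩, (lin_add h a b).symm⟩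
  rw [h2] at h1
  have h3 := Finset.card_image_le (s := P + Q) (f := lin h)
  rw [← Finset.coe_add, Set.ncard_coe_finset, Set.ncard_coe_finset, Set.ncard_coe_finset]
  omega

/-! ### The boundary of a sumset -/

/-- Rotating a supporting functional counterclockwise until it exposes a further point. -/
lemma exists_face_rotate {X : Set Plane} (hfin : X.Finite) {f x : Plane}
    (hf : x ∈ face X f) (hy : ∃ y ∈ X, lin (rot f) x < lin (rot f) y) :
    ∃ g, lin g g = 1 ∧ x ∈ face X g ∧ ∃ y ∈ face X g, lin (rot g) x < lin (rot g) y := by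
  -- Normals are scaled to unit length so that each edge has only one.
  suffices H : ∃ g, g ≠ 0 ∧ x ∈ face X g ∧ ∃ y ∈ face X g, lin (rot g) x < lin (rot g) y by
    obtain ⟨g, hg0, hx, y, hy, hxy⟩ := H
    have hp := lin_self_pos hg0
    have hs : 0 < (√(lin g g))⁻¹ := inv_pos.2 (Real.sqrt_pos.2 hp)
    refine ⟨(√(lin g g))⁻¹ • g, ?_, (mem_face_smul hs).2 hx, y, (mem_face_smul hs).2 hy, ?_⟩
    · rw [smul_lin, lin_smul, ← mul_assoc, ← mul_inv, Real.mul_self_sqrt hp.le,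
        inv_mul_cancel₀ hp.ne']
    · have : ∀ z, lin (rot ((√(lin g g))⁻¹ • g)) z = (√(lin g g))⁻¹ * lin (rot g) z := by
        intro z; simp [lin]; ring
      rw [this, this]
      exact mul_lt_mul_of_pos_left hxy hs
  set e := rot f with he
  -- As `f` is tilted towards `e`, the minimizing `y` is the first point to catch up with `x`; the
  -- quotient is the amount of tilting needed.
  obtain ⟨y, ⟨hyX, hye⟩, hmin⟩ := Set.exists_min_image {y | y ∈ X ∧ lin e x < lin e y}
    (fun y => (lin f x - lin f y) / (lin e y - lin e x)) (hfin.subset fun y hy => hy.1) hy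
  set s := (lin f x - lin f y) / (lin e y - lin e x) with hs
  have hs0 : 0 ≤ s := div_nonneg (sub_nonneg.2 (hf.2 y hyX)) (sub_pos.2 hye).le
  have hsy : s * (lin e y - lin e x) = lin f x - lin f y := div_mul_cancel₀ _ (sub_pos.2 hye).ne'
  have hle : ∀ z ∈ X, lin (f + s • e) z ≤ lin (f + s • e) x := by
    intro z hz
    simp only [add_lin, smul_lin]
    by_cases hze : lin e x < lin e z
    · have := hmin z ⟨hz, hze⟩
      rw [le_div_iff₀ (sub_pos.2 hze)] at this
      linarith
    · have := mul_le_mul_of_nonneg_left (not_lt.1 hze) hs0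
      have := hf.2 z hz
      linarith
  have hxy : lin (f + s • e) y = lin (f + s • e) x := by
    simp only [add_lin, smul_lin]; linarith
  have hrot : ∀ z, lin (rot (f + s • e)) z = lin e z - s * lin f z := by
    intro z; simp [lin, he]; ring
  have hlt : lin (rot (f + s • e)) x < lin (rot (f + s • e)) y := by
    rw [hrot, hrot]
    have := mul_nonneg hs0 (sub_nonneg.2 (hf.2 y hyX))
    linarith
  refine ⟨f + s • e, ?_, ⟨hf.1, hle⟩, y, ⟨hyX, fun z hz => (hle z hz).trans hxy.ge⟩, hlt⟩
  intro h0
  rw [h0] at hlt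
  simp [lin] at hlt

/-- Every boundary point is followed by another point on some edge. -/
lemma exists_edge_normal {X : Set Plane} (hX : ¬ Collinear ℝ X) (hfin : X.Finite) {f x : Plane}
    (hf0 : f ≠ 0) (hf : x ∈ face X f) :
    ∃ g, lin g g = 1 ∧ x ∈ face X g ∧ ∃ y ∈ face X g, lin (rot g) x < lin (rot g) y := by
  by_cases hy : ∃ y ∈ X, lin (rot f) x < lin (rot f) y
  · exact exists_face_rotate hfin hf hy
  -- Here `x` is already extreme for `rot f`, so the rotation can start a quarter turn later.
  · push Not at hy
    obtain ⟨y, hyX, hyx⟩ := exists_lin_lt hX hf0 hf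
    refine exists_face_rotate hfin ⟨hf.1, hy⟩ ⟨y, hyX, ?_⟩
    have : ∀ z, lin (rot (rot f)) z = -lin f z := by intro z; simp [lin]; ring
    rw [this, this]
    linarith

/-- The points of the face exposed by `g` other than the last one in counterclockwise order. -/
def openFace (X : Set Plane) (g : Plane) : Set Plane :=
  {x | x ∈ face X g ∧ ∃ y ∈ face X g, lin (rot g) x < lin (rot g) y}

lemma injOn_lin_rot_face (X : Set Plane) {g : Plane} (hg : g ≠ 0) :
    Set.InjOn (lin (rot g)) (face X g) := by
  intro x hx y hy hxy
  refine eq_of_lin_eq (f := rot g) (g := g) ?_ hxy (lin_eq_of_mem_face hx hy)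
  have := lin_self_pos (rot_ne_zero hg)
  exact this.ne'

lemma ncard_openFace {X : Set Plane} (hfin : X.Finite) (hne : X.Nonempty) {g : Plane} (hg : g ≠ 0) :
    (openFace X g).ncard + 1 = (face X g).ncard := by
  have ff := hfin.subset (face_subset X g)
  obtain ⟨y, hy, hmax⟩ := Set.exists_max_image _ (lin (rot g)) ff (face_nonempty hfin hne g)
  have : openFace X g = face X g \ {y} := by
    ext x
    constructor
    · rintro ⟨hx, z, hz, hxz⟩
      refine ⟨hx, fun h => ?_⟩
      rw [Set.mem_singleton_iff] at h
      subst h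
      exact absurd (hmax z hz) (not_le.2 hxz)
    · rintro ⟨hx, hxy⟩
      exact ⟨hx, y, hy, lt_of_le_of_ne (hmax x hx)
        fun h => hxy (injOn_lin_rot_face X hg hx hy h)⟩
  rw [this]
  exact Set.ncard_sdiff_singleton_add_one hy ff

/-- If `x` is not the last point of the face of `g`, a later point lies in direction `rot g`, so any
functional supporting at `x` is nonpositive on `rot g`. Applied both ways, antisymmetry makes `g`
and `g'` proportional, and `g' = -g` is impossible for a non-collinear set. -/
lemma disjoint_openFace {X : Set Plane} (hX : ¬ Collinear ℝ X) {g g' : Plane} (hg : lin g g = 1)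
    (hg' : lin g' g' = 1) (hne : g ≠ g') : Disjoint (openFace X g) (openFace X g') := by
  have key : ∀ {g g' x : Plane}, lin g g = 1 → x ∈ openFace X g → x ∈ openFace X g' →
      lin g' (rot g) ≤ 0 := by
    rintro g g' x hg ⟨hx, y, hy, hxy⟩ ⟨hx', -⟩
    have hg0 : g ≠ 0 := by rintro rfl; simp [zero_lin] at hg
    have h0 : lin g (y - x) = 0 := by rw [lin_sub, lin_eq_of_mem_face hx hy, sub_self]
    obtain ⟨c, hc⟩ := exists_smul_rot hg0 h0
    have h1 := congrArg (lin (rot g)) hc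
    have h2 := congrArg (lin g') hc
    rw [lin_sub, lin_smul] at h1 h2
    have hp := lin_self_pos (rot_ne_zero hg0)
    have h3 := hx'.2 y hy.1
    have hcpos : 0 < c := by
      by_contra! hc0
      have := mul_nonneg (neg_nonneg.2 hc0) hp.le
      linarith
    by_contra! h4
    have := mul_pos hcpos h4
    linarith
  rw [Set.disjoint_left]
  intro x hx hx'
  have h1 := key hg hx hx'
  have h2 := key hg' hx' hx
  have hg0 : g ≠ 0 := by rintro rfl; simp [zero_lin] at hg
  obtain ⟨c, hc⟩ := exists_smul_of_lin_rot_eq_zero hg0 (le_antisymm h1 (by rw [lin_rot]; linarith))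
  have hcc : c * c = 1 := by
    rw [hc, lin_smul, smul_lin, hg] at hg'
    linarith
  rcases mul_self_eq_one_iff.1 hcc with rfl | rfl
  · exact hne (by rw [hc, one_smul])
  · rw [neg_smul, one_smul] at hc
    exact face_disjoint_face_neg hX hg0 hx.1 (hc ▸ hx'.1)

/-- Omitting one endpoint of each face exactly absorbs the loss of one in the one-dimensional sumset
bound. -/
lemma ncard_openFace_add {A B : Set Plane} (hA : A.Finite) (hB : B.Finite) (hA0 : A.Nonempty)
    (hB0 : B.Nonempty) {g : Plane} (hg : g ≠ 0) :
    (openFace A g).ncard + (openFace B g).ncard ≤ (openFace (A + B) g).ncard := by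
  have h1 := ncard_openFace hA hA0 hg
  have h2 := ncard_openFace hB hB0 hg
  have h3 := ncard_openFace (hA.add hB) (hA0.add hB0) hg
  have h4 := ncard_add_ge (h := rot g) (hA.subset (face_subset A g)) (hB.subset (face_subset B g))
    (face_nonempty hA hA0 g) (face_nonempty hB hB0 g) (injOn_lin_rot_face A hg)
    (injOn_lin_rot_face B hg)
  rw [face_add] at h3
  omega

lemma exists_finset_normals {X : Set Plane} (hX : ¬ Collinear ℝ X) (hfin : X.Finite) :
    ∃ G : Finset Plane, (∀ g ∈ G, lin g g = 1) ∧
      ∀ x ∈ X ∩ frontier (convexHull ℝ X), ∃ g ∈ G, x ∈ openFace X g := by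
  classical
  have hfb : (X ∩ frontier (convexHull ℝ X)).Finite := hfin.subset Set.inter_subset_left
  have : ∀ x : Plane, ∃ g : Plane, x ∈ X ∩ frontier (convexHull ℝ X) →
      lin g g = 1 ∧ x ∈ openFace X g := by
    intro x
    by_cases hx : x ∈ X ∩ frontier (convexHull ℝ X)
    · obtain ⟨w, hw, hxw⟩ := (mem_frontier_convexHull_iff hX hx.1).1 hx.2
      obtain ⟨g, hg, hxg, hy⟩ := exists_edge_normal hX hfin hw hxw
      exact ⟨g, fun _ => ⟨hg, hxg, hy⟩⟩
    · exact ⟨0, fun h => absurd h hx⟩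
  choose γ hγ using this
  refine ⟨hfb.toFinset.image γ, ?_, fun x hx => ⟨γ x, ?_, (hγ x hx).2⟩⟩
  · intro g hg
    obtain ⟨x, hx, rfl⟩ := Finset.mem_image.1 hg
    exact (hγ x (hfb.mem_toFinset.1 hx)).1
  · exact Finset.mem_image_of_mem _ (hfb.mem_toFinset.2 hx)

lemma boundaryCount_le_sum {X : Set Plane} (hfin : X.Finite) {G : Finset Plane}
    (hG : ∀ x ∈ X ∩ frontier (convexHull ℝ X), ∃ g ∈ G, x ∈ openFace X g) :
    boundaryCount X ≤ ∑ g ∈ G, (openFace X g).ncard := by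
  have hsub : X ∩ frontier (convexHull ℝ X) ⊆ ⋃ g ∈ G, openFace X g := fun x hx => by
    simpa using hG x hx
  have hf : (⋃ g ∈ G, openFace X g).Finite :=
    hfin.subset (Set.iUnion₂_subset fun g _ x hx => hx.1.1)
  exact (Set.ncard_le_ncard hsub hf).trans (Finset.set_ncard_biUnion_le G _)

lemma sum_le_boundaryCount {X : Set Plane} (hX : ¬ Collinear ℝ X) (hfin : X.Finite)
    {G : Finset Plane} (hG : ∀ g ∈ G, lin g g = 1) :
    ∑ g ∈ G, (openFace X g).ncard ≤ boundaryCount X := by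
  have hdisj : (G : Set Plane).PairwiseDisjoint (openFace X) := fun g hg g' hg' hne =>
    disjoint_openFace hX (hG g hg) (hG g' hg') hne
  have hf : ∀ g ∈ (G : Set Plane), (openFace X g).Finite := fun g _ =>
    hfin.subset fun x hx => hx.1.1
  rw [← finsum_mem_coe_finset, ← G.finite_toSet.ncard_biUnion hf hdisj]
  refine Set.ncard_le_ncard ?_ (hfin.subset Set.inter_subset_left)
  refine Set.iUnion₂_subset fun g hg x hx => ⟨hx.1.1, ?_⟩
  refine (mem_frontier_convexHull_iff hX hx.1.1).2 ⟨g, ?_, hx.1⟩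
  rintro rfl
  simpa [zero_lin] using hG 0 hg

/-- The number of boundary points is superadditive. -/
lemma boundaryCount_add_le {A B : Set Plane} (hA : A.Finite) (hB : B.Finite)
    (hAc : ¬ Collinear ℝ A) (hBc : ¬ Collinear ℝ B) :
    boundaryCount A + boundaryCount B ≤ boundaryCount (A + B) := by
  classical
  have hA0 := nonempty_of_not_collinear hAc
  have hB0 := nonempty_of_not_collinear hBc
  obtain ⟨G, hG1, hG2⟩ := exists_finset_normals hAc hA
  obtain ⟨H, hH1, hH2⟩ := exists_finset_normals hBc hB
  have hGH : ∀ g ∈ G ∪ H, lin g g = 1 := fun g hg =>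
    (Finset.mem_union.1 hg).elim (hG1 g) (hH1 g)
  calc boundaryCount A + boundaryCount B
      ≤ ∑ g ∈ G ∪ H, (openFace A g).ncard + ∑ g ∈ G ∪ H, (openFace B g).ncard := by
        refine add_le_add (boundaryCount_le_sum hA fun x hx => ?_)
          (boundaryCount_le_sum hB fun x hx => ?_)
        · obtain ⟨g, hg, h⟩ := hG2 x hx
          exact ⟨g, Finset.mem_union_left _ hg, h⟩
        · obtain ⟨g, hg, h⟩ := hH2 x hx
          exact ⟨g, Finset.mem_union_right _ hg, h⟩
    _ = ∑ g ∈ G ∪ H, ((openFace A g).ncard + (openFace B g).ncard) := Finset.sum_add_distrib.symm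
    _ ≤ ∑ g ∈ G ∪ H, (openFace (A + B) g).ncard := by
        refine Finset.sum_le_sum fun g hg => ncard_openFace_add hA hB hA0 hB0 ?_
        rintro rfl
        simpa [zero_lin] using hGH 0 hg
    _ ≤ boundaryCount (A + B) :=
        sum_le_boundaryCount (not_collinear_add hAc hB0) (hA.add hB) hGH

/-! ### Generic directions -/

/-- Rotating a direction slightly makes it injective on a given finite set. -/
lemma eventually_injOn_lin {X : Set Plane} (hX : X.Finite) {h : Plane} (hh : h ≠ 0) :
    ∀ᶠ ε in nhdsWithin (0 : ℝ) (Set.Ioi 0), Set.InjOn (lin (h + ε • rot h)) X := by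
  -- For each pair of distinct points at most one `ε` puts both on the same level; this finite set
  -- collects those values.
  have hfin : ((fun d : Plane × Plane => -lin h (d.1 - d.2) / lin (rot h) (d.1 - d.2)) ''
      (X ×ˢ X)).Finite := (hX.prod hX).image _
  have hle : nhdsWithin (0 : ℝ) (Set.Ioi 0) ≤ Filter.cofinite :=
    (nhdsWithin_mono (0 : ℝ) (show Set.Ioi (0 : ℝ) ⊆ {0}ᶜ from fun x hx => ne_of_gt hx)).trans (nhdsNE_le_cofinite 0)
  filter_upwards [hle hfin.eventually_cofinite_notMem] with ε hε x hx y hy hxy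
  by_contra hne
  have h1 : lin h (x - y) + ε * lin (rot h) (x - y) = 0 := by
    simp only [add_lin, smul_lin] at hxy
    simp only [lin_sub]
    linarith
  by_cases h0 : lin (rot h) (x - y) = 0
  · rw [h0] at h1
    refine hne (eq_of_lin_eq (f := rot h) (g := h) (lin_self_pos (rot_ne_zero hh)).ne' ?_ ?_)
    · rw [lin_sub] at h0; linarith
    · rw [lin_sub] at h1; linarith
  · refine hε ⟨(x, y), ⟨hx, hy⟩, ?_⟩
    simp only
    rw [div_eq_iff h0]
    linarith

lemma perturb_ne_zero {h : Plane} (hh : h ≠ 0) (ε : ℝ) : h + ε • rot h ≠ 0 := by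
  have : lin (h + ε • rot h) h = lin h h := by
    rw [add_lin, smul_lin, show lin (rot h) h = 0 by simp [lin]; ring]; ring
  exact ne_zero_of_lin_ne_zero (this ▸ (lin_self_pos hh).ne')

lemma exists_injOn_lin {X : Set Plane} (hX : X.Finite) :
    ∃ h : Plane, h ≠ 0 ∧ Set.InjOn (lin h) X := by
  have h1 : (!₂[1, 0] : Plane) ≠ 0 := fun h => by
    have := congrArg (fun v : Plane => v 0) h; simp at this
  obtain ⟨ε, hε⟩ := (eventually_injOn_lin hX h1).exists
  exact ⟨_, perturb_ne_zero h1 ε, hε⟩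

lemma injOn_lin_neg {X : Set Plane} {h : Plane} (hi : Set.InjOn (lin h) X) :
    Set.InjOn (lin (-h)) X := fun x hx y hy hxy => hi hx hy (by simpa [neg_lin] using hxy)

lemma ncard_face_of_injOn {X : Set Plane} (hfin : X.Finite) (hne : X.Nonempty) {h : Plane}
    (hi : Set.InjOn (lin h) X) : (face X h).ncard = 1 := by
  obtain ⟨x, hx⟩ := face_nonempty hfin hne h
  rw [Set.ncard_eq_one]
  refine ⟨x, Set.eq_singleton_iff_unique_mem.2 ⟨hx, fun y hy => ?_⟩⟩
  exact hi hy.1 hx.1 (lin_eq_of_mem_face hy hx)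

/-! ### Sets with at least four points -/

/-- Some line through two points of `A` has points of `A` strictly on both sides. -/
lemma exists_separating_line {A : Set Plane} (hA : ¬ Collinear ℝ A)
    (hb : ∀ x ∈ A, ∃ w, w ≠ 0 ∧ x ∈ face A w) (h4 : 4 ≤ A.ncard) :
    ∃ h : Plane, h ≠ 0 ∧ ∃ p ∈ A, ∃ q ∈ A, ∃ s ∈ A, ∃ t ∈ A, p ≠ q ∧ lin h p = lin h q ∧
      lin h p < lin h s ∧ lin h t < lin h p := by
  by_contra hcon
  -- Without a separating line, every line through two points of `A` has `A` on one closed side.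
  -- Applied to the sides of a triangle `a b c`, this confines a fourth point `d` to the closed
  -- triangle.
  have H : ∀ p ∈ A, ∀ q ∈ A, ∀ s ∈ A, ∀ t ∈ A, p ≠ q → 0 < lin (rot (q - p)) (s - p) →
      0 ≤ lin (rot (q - p)) (t - p) := by
    intro p hp q hq s hs t ht hpq h1
    by_contra! h2
    rw [lin_sub] at h1 h2
    refine hcon ⟨rot (q - p), rot_ne_zero (sub_ne_zero.2 hpq.symm), p, hp, q, hq, s, hs, t, ht, hpq,
      ?_, by linarith, by linarith⟩
    simp [lin]; ring
  obtain ⟨a, ha⟩ := nonempty_of_not_collinear hA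
  obtain ⟨b, hbA, hab⟩ : ∃ b ∈ A, b ≠ a := by
    by_contra! h
    refine hA ((collinear_singleton ℝ a).subset fun x hx => ?_)
    exact h x hx
  obtain ⟨c, hc, hcr⟩ : ∃ c ∈ A, lin (rot (b - a)) (c - a) ≠ 0 := by
    by_contra! h
    refine hA (collinear_iff_lin.2 ⟨_, rot_ne_zero (sub_ne_zero.2 hab), lin (rot (b - a)) a,
      fun x hx => ?_⟩)
    have := h x hx
    rw [lin_sub] at this
    linarith
  wlog hpos : 0 < lin (rot (b - a)) (c - a) generalizing a b
  · have hsw : lin (rot (a - b)) (c - b) = -lin (rot (b - a)) (c - a) := by simp [lin]; ring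
    refine this b hbA a ha hab.symm (by rw [hsw]; simpa using hcr) ?_
    rw [hsw]
    have := lt_of_le_of_ne (not_lt.1 hpos) hcr
    linarith
  obtain ⟨d, hd, hdn⟩ : ∃ d ∈ A, d ∉ ({a, b, c} : Set Plane) := by
    by_contra! h
    have h1 := Set.ncard_le_ncard (show A ⊆ {a, b, c} from h) (Set.toFinite _)
    have h2 : ({a, b, c} : Set Plane).ncard ≤ 3 := by
      refine (Set.ncard_insert_le _ _).trans ?_
      have := Set.ncard_insert_le b {c}
      rw [Set.ncard_singleton] at this
      omega
    omega
  simp only [Set.mem_insert_iff, Set.mem_singleton_iff, not_or] at hdn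
  obtain ⟨hda, hdb, hdc⟩ := hdn
  have hbc : b ≠ c := by
    rintro rfl
    exact hcr (by simp [lin]; ring)
  have hca : c ≠ a := by
    rintro rfl
    exact hcr (by simp [lin])
  have hγ := H a ha b hbA c hc d hd hab.symm hpos
  have hα := H b hbA c hc a ha d hd hbc (by
    have : lin (rot (c - b)) (a - b) = lin (rot (b - a)) (c - a) := by simp [lin]; ring
    rwa [this])
  have hβ := H c hc a ha b hbA d hd hca (by
    have : lin (rot (a - c)) (b - c) = lin (rot (b - a)) (c - a) := by simp [lin]; ring
    rwa [this])
  -- a point on the side of two vertices, other than these, is separated by the third vertex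
  have edge : ∀ x ∈ A, ∀ y ∈ A, ∀ z ∈ A, d ≠ x → d ≠ y → d ≠ z →
      lin (rot (y - x)) (z - x) ≠ 0 → lin (rot (y - x)) (d - x) = 0 →
      0 ≤ lin (rot (z - y)) (d - y) → 0 ≤ lin (rot (x - z)) (d - z) → False := by
    intro x hx y hy z hz hdx hdy hdz hxyz h0 h1 h2
    have e1 : lin (rot (d - z)) (x - z) = -lin (rot (x - z)) (d - z) := by simp [lin]; ring
    have e2 : lin (rot (d - z)) (y - z) = lin (rot (z - y)) (d - y) := by simp [lin]; ring
    have hy0 : lin (rot (z - y)) (d - y) ≠ 0 := by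
      intro h
      refine hdy (eq_of_lin_eq (f := rot (y - x)) (g := rot (z - y)) ?_ ?_ ?_)
      · intro h'; apply hxyz; rw [← neg_eq_zero, ← h']; simp [lin]; ring
      · rw [lin_sub] at h0; rw [sub_eq_zero.1 h0]; simp [lin]; ring
      · rw [lin_sub] at h; linarith
    have hx0 : lin (rot (x - z)) (d - z) ≠ 0 := by
      intro h
      refine hdx (eq_of_lin_eq (f := rot (y - x)) (g := rot (x - z)) ?_ ?_ ?_)
      · intro h'; apply hxyz; rw [← h']; simp [lin]
      · rw [lin_sub] at h0; linarith
      · rw [lin_sub] at h; rw [sub_eq_zero.1 h]; simp [lin]; ring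
    have := H z hz d hd y hy x hx hdz.symm (by rw [e2]; exact lt_of_le_of_ne h1 hy0.symm)
    rw [e1] at this
    exact hx0 (le_antisymm (by linarith) h2)
  by_cases g0 : lin (rot (b - a)) (d - a) = 0
  · exact edge a ha b hbA c hc hda hdb hdc hcr g0 hα hβ
  by_cases a0 : lin (rot (c - b)) (d - b) = 0
  · refine edge b hbA c hc a ha hdb hdc hda ?_ a0 hβ hγ
    have : lin (rot (c - b)) (a - b) = lin (rot (b - a)) (c - a) := by simp [lin]; ring
    rwa [this]
  by_cases b0 : lin (rot (a - c)) (d - c) = 0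
  · refine edge c hc a ha b hbA hdc hda hdb ?_ b0 hγ hα
    have : lin (rot (a - c)) (b - c) = lin (rot (b - a)) (c - a) := by simp [lin]; ring
    rwa [this]
  have gp := lt_of_le_of_ne hγ (Ne.symm g0)
  have ap := lt_of_le_of_ne hα (Ne.symm a0)
  have bp := lt_of_le_of_ne hβ (Ne.symm b0)
  obtain ⟨w, hw, hdw⟩ := hb d hd
  -- The unnormalized barycentric identity for `d`. Its weights are positive, so a functional
  -- maximal at `d` takes equal values at `a`, `b`, `c`.
  have hsum : lin (rot (c - b)) (d - b) * (lin w d - lin w a) +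
      lin (rot (a - c)) (d - c) * (lin w d - lin w b) +
      lin (rot (b - a)) (d - a) * (lin w d - lin w c) = 0 := by
    simp [lin]; ring
  have ka := sub_nonneg.2 (hdw.2 a ha)
  have kb := sub_nonneg.2 (hdw.2 b hbA)
  have kc := sub_nonneg.2 (hdw.2 c hc)
  have ma := mul_nonneg ap.le ka
  have mb := mul_nonneg bp.le kb
  have mc := mul_nonneg gp.le kc
  have za : lin w d - lin w a = 0 :=
    (mul_eq_zero.1 (le_antisymm (by linarith) ma)).resolve_left a0
  have zb : lin w d - lin w b = 0 :=
    (mul_eq_zero.1 (le_antisymm (by linarith) mb)).resolve_left b0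
  have zc : lin w d - lin w c = 0 :=
    (mul_eq_zero.1 (le_antisymm (by linarith) mc)).resolve_left g0
  obtain ⟨k, hk⟩ := exists_smul_rot (x := b - a) hw (by rw [lin_sub]; linarith)
  obtain ⟨l, hl⟩ := exists_smul_rot (x := c - a) hw (by rw [lin_sub]; linarith)
  rw [hk, hl] at hcr
  exact hcr (by simp [lin]; ring)

/-- There is a generic direction for which both chains of `A` are nonempty. -/
lemma exists_generic_chains {A B : Set Plane} (hA : ¬ Collinear ℝ A) (hfin : A.Finite)
    (hBfin : B.Finite) (hb : ∀ x ∈ A, ∃ w, w ≠ 0 ∧ x ∈ face A w) (h4 : 4 ≤ A.ncard) :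
    ∃ h : Plane, h ≠ 0 ∧ Set.InjOn (lin h) A ∧ Set.InjOn (lin h) B ∧
      (chain A h).Nonempty ∧ (chain A (-h)).Nonempty := by
  obtain ⟨h, hh, p, hp, q, hq, s, hs, t, ht, hpq, heq, hps, htp⟩ :=
    exists_separating_line hA hb h4
  obtain ⟨c, hc⟩ := exists_smul_rot (x := p - q) hh (by rw [lin_sub]; linarith)
  wlog hc0 : 0 < c generalizing p q c
  · refine this q hq p hp hpq.symm heq.symm (heq ▸ hps) (heq ▸ htp) (-c)
      (by rw [neg_smul, ← hc, neg_sub]) ?_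
    have : c ≠ 0 := by
      rintro rfl
      exact hpq (sub_eq_zero.1 (by rw [hc, zero_smul]))
    have := lt_of_le_of_ne (not_lt.1 hc0) this
    linarith
  have mid : ∀ x : Plane, lin h x < lin h s → lin h t < lin h x →
      x ∉ face A h ∧ x ∉ face A (-h) := by
    intro x h1 h2
    refine ⟨fun hf => absurd (hf.2 s hs) (not_le.2 h1), fun hf => ?_⟩
    have := hf.2 t ht
    simp only [neg_lin] at this
    linarith
  obtain ⟨f, hf0, hpf⟩ := hb p hp
  obtain ⟨g, hg0, hqg⟩ := hb q hq
  -- Since `p` is further along `rot h` than `q`, a functional maximal at `p` is nonnegative on `rot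
  -- h`; it is nonzero there because `p` is on neither extreme level.
  have hfp : 0 < lin f (rot h) := by
    refine lt_of_le_of_ne ?_ fun h0 =>
      hf0 (eq_zero_of_mid hh (mid p hps htp).1 (mid p hps htp).2 hpf h0.symm)
    have h1 := congrArg (lin f) hc
    rw [lin_sub, lin_smul] at h1
    have h2 := hpf.2 q hq
    by_contra! h3
    have := mul_neg_of_pos_of_neg hc0 h3
    linarith
  have hgn : lin g (rot h) < 0 := by
    refine lt_of_le_of_ne ?_ fun h0 =>
      hg0 (eq_zero_of_mid hh (mid q (heq ▸ hps) (heq ▸ htp)).1 (mid q (heq ▸ hps) (heq ▸ htp)).2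
        hqg h0)
    have h1 := congrArg (lin g) hc
    rw [lin_sub, lin_smul] at h1
    have h2 := hqg.2 p hp
    by_contra! h3
    have := mul_pos hc0 h3
    linarith
  have cont : ∀ x, Filter.Tendsto (fun ε : ℝ => lin (h + ε • rot h) x)
      (nhdsWithin (0 : ℝ) (Set.Ioi 0)) (nhds (lin h x)) := by
    intro x
    have : Continuous (fun ε : ℝ => lin (h + ε • rot h) x) := by
      simp only [add_lin, smul_lin]; fun_prop
    have h2 := this.tendsto 0
    simp only [zero_smul, add_zero] at h2
    exact h2.mono_left nhdsWithin_le_nhds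
  have contr : ∀ x, Filter.Tendsto (fun ε : ℝ => lin x (rot (h + ε • rot h)))
      (nhdsWithin (0 : ℝ) (Set.Ioi 0)) (nhds (lin x (rot h))) := by
    intro x
    have := (cont (rot x)).neg
    simpa only [lin_rot x] using this
  -- The remaining conditions are strict inequalities, so they survive a small perturbation that
  -- makes `h` generic for both sets.
  obtain ⟨ε, e1, e2, e3, e4, e5, e6, e7, e8⟩ :=
    ((eventually_injOn_lin hfin hh).and ((eventually_injOn_lin hBfin hh).and
      (((cont p).eventually_lt (cont s) hps).and (((cont t).eventually_lt (cont p) htp).and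
      (((cont q).eventually_lt (cont s) (heq ▸ hps)).and
      (((cont t).eventually_lt (cont q) (heq ▸ htp)).and
      (((contr f).eventually_const_lt hfp).and
        ((contr g).eventually_lt_const hgn)))))))).exists
  set k := h + ε • rot h
  refine ⟨k, perturb_ne_zero hh ε, e1, e2, ⟨p, hp, ?_, ?_, f, hpf, e7⟩,
    ⟨q, hq, ?_, ?_, g, hqg, by rw [lin_rot_neg]; linarith⟩⟩
  · exact fun hf => absurd (hf.2 s hs) (not_le.2 e3)
  · intro hf
    have := hf.2 t ht
    simp only [neg_lin] at this
    linarith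
  · intro hf
    have := hf.2 t ht
    simp only [neg_lin] at this
    linarith
  · rw [neg_neg]
    exact fun hf => absurd (hf.2 s hs) (not_le.2 e5)

/-- A common supporting functional would be both positive and negative on `rot h`. -/
lemma chain_add_chain_subset {A B : Set Plane} (hA : ¬ Collinear ℝ A) (hB : ¬ Collinear ℝ B)
    {h : Plane} (hh : h ≠ 0) :
    chain A h + chain B (-h) ⊆ (A + B) ∩ interior (convexHull ℝ (A + B)) := by
  rintro _ ⟨a, ha, b, hb, rfl⟩
  refine add_mem_interior hA hB ha.1 hb.1 fun w hw h1 h2 => ?_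
  have p1 := lin_rot_pos_of_mem_chain hA hh ha h1 hw
  have p2 := lin_rot_pos_of_mem_chain hB (neg_ne_zero.2 hh) hb h2 hw
  rw [lin_rot_neg] at p2
  linarith

lemma chains_le_interiorCount {A B : Set Plane} (hA : ¬ Collinear ℝ A) (hB : ¬ Collinear ℝ B)
    (hAf : A.Finite) (hBf : B.Finite) {h : Plane} (hh : h ≠ 0) (h1 : (chain A h).Nonempty)
    (h2 : (chain B (-h)).Nonempty) :
    (chain A h).ncard + (chain B (-h)).ncard ≤ interiorCount (A + B) + 1 := by
  refine (ncard_add_ge (h := h) (hAf.subset (chain_subset A h)) (hBf.subset (chain_subset B (-h)))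
    h1 h2 (injOn_lin_chain A hh) (injOn_lin_chain_neg B hh)).trans ?_
  have := Set.ncard_le_ncard (chain_add_chain_subset hA hB hh)
    ((hAf.add hBf).subset Set.inter_subset_left)
  unfold interiorCount
  omega

lemma interiorCount_ge_of_four_le {A B : Set Plane} (hA : ¬ Collinear ℝ A) (hB : ¬ Collinear ℝ B)
    (hAf : A.Finite) (hBf : B.Finite) (hAb : ∀ x ∈ A, ∃ w, w ≠ 0 ∧ x ∈ face A w)
    (hBb : ∀ x ∈ B, ∃ w, w ≠ 0 ∧ x ∈ face B w) (h4 : 4 ≤ A.ncard) (hle : A.ncard ≤ B.ncard) :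
    A.ncard + B.ncard ≤ 2 * interiorCount (A + B) + 6 := by
  obtain ⟨h, hh, iA, iB, n1, n2⟩ := exists_generic_chains (B := B) hA hAf hBf hAb h4
  have hA0 := nonempty_of_not_collinear hA
  have hB0 := nonempty_of_not_collinear hB
  have cA := (ncard_eq_boundaryCount hA hAb).trans (boundaryCount_eq_chain hA hAf hh)
  have cB := (ncard_eq_boundaryCount hB hBb).trans (boundaryCount_eq_chain hB hBf hh)
  rw [ncard_face_of_injOn hAf hA0 iA, ncard_face_of_injOn hAf hA0 (injOn_lin_neg iA)] at cA
  rw [ncard_face_of_injOn hBf hB0 iB, ncard_face_of_injOn hBf hB0 (injOn_lin_neg iB)] at cB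
  have fA := (Set.ncard_pos (hAf.subset (chain_subset A h))).2 n1
  have fA' := (Set.ncard_pos (hAf.subset (chain_subset A (-h)))).2 n2
  -- One of the two pairings of opposite chains holds at least half of all chain points. Its part in
  -- `B` is nonempty: a chain of `A` alone has at most `|A| - 3` points, which is too few because
  -- `|A| ≤ |B|`.
  by_cases hc : A.ncard + B.ncard ≤ 2 * ((chain A h).ncard + (chain B (-h)).ncard) + 4
  · have n3 : (chain B (-h)).Nonempty := Set.nonempty_of_ncard_ne_zero (by omega)
    have := chains_le_interiorCount hA hB hAf hBf hh n1 n3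
    omega
  · have n3 : (chain B (-(-h))).Nonempty :=
      Set.nonempty_of_ncard_ne_zero (by rw [neg_neg]; omega)
    have := chains_le_interiorCount hA hB hAf hBf (neg_ne_zero.2 hh) n2 n3
    rw [neg_neg] at this
    omega

/-! ### Triangles -/

/-- Such an `f` is a multiple of `h`. A positive multiple would put `a` on the `h`-face of `A`; a
negative one would put `b` on two opposite faces of `B`. -/
lemma eq_zero_of_mem_face_of_lin_rot_eq_zero {A B : Set Plane} (hB : ¬ Collinear ℝ B) {h a b f : Plane}
    (hh : h ≠ 0) (ha : a ∉ face A h) (hb : b ∈ face B h) (hfa : a ∈ face A f)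
    (hfb : b ∈ face B f) (h0 : lin f (rot h) = 0) : f = 0 := by
  obtain ⟨c, rfl⟩ := exists_smul_of_lin_rot_eq_zero hh h0
  rcases lt_trichotomy c 0 with hc | rfl | hc
  · rw [show c • h = (-c) • (-h) by simp, mem_face_smul (by linarith)] at hfb
    exact (face_disjoint_face_neg hB hh hb hfb).elim
  · simp
  · exact absurd ((mem_face_smul hc).1 hfa) ha

/-- The points of the face exposed by `h` other than its two ends. -/
def innerFace (X : Set Plane) (h : Plane) : Set Plane :=
  {x | x ∈ openFace X h ∧ ∃ y ∈ face X h, lin (rot h) y < lin (rot h) x}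

/-- Only an inequality, since the two ends of a one-point face coincide. -/
lemma ncard_innerFace {X : Set Plane} (hfin : X.Finite) (hne : X.Nonempty) {h : Plane}
    (hh : h ≠ 0) : (face X h).ncard ≤ (innerFace X h).ncard + 2 := by
  have h1 := ncard_openFace hfin hne hh
  obtain ⟨y, hy, hmin⟩ := Set.exists_min_image _ (lin (rot h)) (hfin.subset (face_subset X h))
    (face_nonempty hfin hne h)
  have hsub : openFace X h \ {y} ⊆ innerFace X h := by
    rintro x ⟨hx, hxy⟩
    refine ⟨hx, y, hy, lt_of_le_of_ne (hmin x hx.1) fun he => ?_⟩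
    exact hxy (injOn_lin_rot_face X hh hx.1 hy he.symm)
  have h2 := Set.ncard_le_ncard hsub (hfin.subset fun x hx => hx.1.1.1)
  have h3 := Set.pred_ncard_le_ncard_sdiff_singleton (openFace X h) y
  omega

lemma lin_rot_le_of_mem_openFace {X : Set Plane} {h f x : Plane} (hh : h ≠ 0)
    (hx : x ∈ openFace X h) (hf : x ∈ face X f) : lin f (rot h) ≤ 0 := by
  obtain ⟨hxh, y, hy, hlt⟩ := hx
  obtain ⟨c, hc⟩ := exists_smul_rot (x := y - x) hh
    (by rw [lin_sub, lin_eq_of_mem_face hy hxh, sub_self])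
  have h1 := congrArg (lin (rot h)) hc
  have h2 := congrArg (lin f) hc
  rw [lin_sub, lin_smul] at h1 h2
  have hp := lin_self_pos (rot_ne_zero hh)
  have hcpos : 0 < c := by
    by_contra! hc0
    have := mul_nonneg (neg_nonneg.2 hc0) hp.le
    linarith
  have := hf.2 y hy.1
  by_contra! h3
  have := mul_pos hcpos h3
  linarith

lemma le_lin_rot_of_mem_innerFace {X : Set Plane} {h f x : Plane} (hh : h ≠ 0)
    (hx : x ∈ innerFace X h) (hf : x ∈ face X f) : 0 ≤ lin f (rot h) := by
  obtain ⟨⟨hxh, -⟩, y, hy, hlt⟩ := hx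
  obtain ⟨c, hc⟩ := exists_smul_rot (x := x - y) hh
    (by rw [lin_sub, lin_eq_of_mem_face hy hxh, sub_self])
  have h1 := congrArg (lin (rot h)) hc
  have h2 := congrArg (lin f) hc
  rw [lin_sub, lin_smul] at h1 h2
  have hp := lin_self_pos (rot_ne_zero hh)
  have hcpos : 0 < c := by
    by_contra! hc0
    have := mul_nonneg (neg_nonneg.2 hc0) hp.le
    linarith
  have := hf.2 y hy.1
  by_contra! h3
  have := mul_neg_of_pos_of_neg hcpos h3
  linarith

/-- The points of `A + B` in the interior of the convex hull. -/
def interiorSum (A B : Set Plane) : Set Plane := (A + B) ∩ interior (convexHull ℝ (A + B))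

/-! ### Interior points of the sumset contributed by one side of a triangle -/

section Triangle

variable {A B : Set Plane} {v₁ v₂ v₃ h : Plane}

/-- A functional maximal at `v₁` is nonnegative on `v₁ - v₂ = rot h`, while those supporting `B`
along this chain are negative there. -/
lemma add_chain_neg_mem (hA : ¬ Collinear ℝ A) (hB : ¬ Collinear ℝ B) (h₁ : v₁ ∈ A) (h₂ : v₂ ∈ A)
    (hh : h ≠ 0) (hr : rot h = v₁ - v₂) {b : Plane} (hb : b ∈ chain B (-h)) :
    v₁ + b ∈ interiorSum A B := by
  refine add_mem_interior hA hB h₁ hb.1 fun f hf ha hfb => ?_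
  have p := lin_rot_pos_of_mem_chain hB (neg_ne_zero.2 hh) hb hfb hf
  rw [lin_rot_neg, hr, lin_sub] at p
  have := ha.2 v₂ h₂
  linarith

lemma add_chain_mem (hA : ¬ Collinear ℝ A) (hB : ¬ Collinear ℝ B) (h₁ : v₁ ∈ A) (h₂ : v₂ ∈ A)
    (hh : h ≠ 0) (hr : rot h = v₁ - v₂) {b : Plane} (hb : b ∈ chain B h) :
    v₂ + b ∈ interiorSum A B := by
  refine add_mem_interior hA hB h₂ hb.1 fun f hf ha hfb => ?_
  have p := lin_rot_pos_of_mem_chain hB hh hb hfb hf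
  rw [hr, lin_sub] at p
  have := ha.2 v₁ h₁
  linarith

/-- Maximality at `v₂` and at a point that is not the last of its face bound the value on `rot h`
from both sides, so a common functional vanishes there. -/
lemma add_openFace_neg_mem (hA : ¬ Collinear ℝ A) (hB : ¬ Collinear ℝ B) (h₁ : v₁ ∈ A)
    (h₂ : v₂ ∈ A) (h₃ : v₃ ∈ A) (hh : h ≠ 0) (hr : rot h = v₁ - v₂) (hlt : lin h v₃ < lin h v₂)
    {b : Plane} (hb : b ∈ openFace B (-h)) : v₂ + b ∈ interiorSum A B := by
  refine add_mem_interior hA hB h₂ hb.1.1 fun f hf ha hfb => hf ?_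
  have p := lin_rot_le_of_mem_openFace (neg_ne_zero.2 hh) hb hfb
  refine eq_zero_of_mem_face_of_lin_rot_eq_zero hB (neg_ne_zero.2 hh) ?_ hb.1 ha hfb (le_antisymm p ?_)
  · intro hv
    have := hv.2 v₃ h₃
    simp only [neg_lin] at this
    linarith
  · have := ha.2 v₁ h₁
    rw [lin_rot_neg, hr, lin_sub]
    linarith

lemma add_innerFace_mem (hA : ¬ Collinear ℝ A) (hB : ¬ Collinear ℝ B)
    (h₂ : v₂ ∈ A) (h₃ : v₃ ∈ A) (hh : h ≠ 0) (hlt : lin h v₃ < lin h v₂)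
    {b : Plane} (hb : b ∈ innerFace B h) : v₃ + b ∈ interiorSum A B := by
  refine add_mem_interior hA hB h₃ hb.1.1.1 fun f hf ha hfb => hf ?_
  refine eq_zero_of_mem_face_of_lin_rot_eq_zero hB hh (fun hv => ?_) hb.1.1 ha hfb (le_antisymm
    (lin_rot_le_of_mem_openFace hh hb.1 hfb) (le_lin_rot_of_mem_innerFace hh hb hfb))
  have := hv.2 v₂ h₂
  linarith

/-- If `A + B` has few interior points, where `A` contains the triangle `v₁ v₂ v₃`, then the side
`v₁ v₂` determines the shape of `B` to a large extent. -/
lemma levels_of_few_interior (hA : ¬ Collinear ℝ A) (hB : ¬ Collinear ℝ B) (hAf : A.Finite)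
    (hBf : B.Finite) (hBb : ∀ x ∈ B, ∃ w, w ≠ 0 ∧ x ∈ face B w) (h₁ : v₁ ∈ A) (h₂ : v₂ ∈ A)
    (h₃ : v₃ ∈ A) (hh : h ≠ 0) (hr : rot h = v₁ - v₂) (hlt : lin h v₃ < lin h v₂)
    (hfew : 2 * (interiorSum A B).ncard + 4 ≤ B.ncard) :
    (face B h).ncard = 3 ∧ (face B (-h)).ncard = 1 ∧ B.ncard = 2 * (interiorSum A B).ncard + 4 ∧
    (∀ x ∈ interiorSum A B, x - v₁ ∈ chain B (-h) ∧ x - v₂ ∈ chain B h) ∧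
    ∃ x ∈ interiorSum A B, x - v₃ ∈ face B h := by
  have hB0 := nonempty_of_not_collinear hB
  have hnh := neg_ne_zero.2 hh
  have h12 : lin h v₁ = lin h v₂ := by
    have := congrArg (lin h) hr
    rw [lin_rot_self, lin_sub] at this
    linarith
  set I := interiorSum A B with hI
  have hIf : I.Finite := (hAf.add hBf).subset Set.inter_subset_left
  set SL := (fun b => v₁ + b) '' chain B (-h) with hSL
  set SR := (fun b => v₂ + b) '' chain B h with hSR
  set SB := (fun b => v₂ + b) '' openFace B (-h) with hSB
  set ST := (fun b => v₃ + b) '' innerFace B h with hST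
  have cSL : SL.ncard = (chain B (-h)).ncard := Set.ncard_image_of_injective _ (add_right_injective _)
  have cSR : SR.ncard = (chain B h).ncard := Set.ncard_image_of_injective _ (add_right_injective _)
  have cSB : SB.ncard = (openFace B (-h)).ncard :=
    Set.ncard_image_of_injective _ (add_right_injective _)
  have cST : ST.ncard = (innerFace B h).ncard :=
    Set.ncard_image_of_injective _ (add_right_injective _)
  have sSL : SL ⊆ I := by
    rintro _ ⟨b, hb, rfl⟩; exact add_chain_neg_mem hA hB h₁ h₂ hh hr hb
  have sSR : SR ⊆ I := by
    rintro _ ⟨b, hb, rfl⟩; exact add_chain_mem hA hB h₁ h₂ hh hr hb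
  have sSB : SB ⊆ I := by
    rintro _ ⟨b, hb, rfl⟩; exact add_openFace_neg_mem hA hB h₁ h₂ h₃ hh hr hlt hb
  have sST : ST ⊆ I := by
    rintro _ ⟨b, hb, rfl⟩; exact add_innerFace_mem hA hB h₂ h₃ hh hlt hb
  obtain ⟨bt, hbt⟩ := face_nonempty hBf hB0 h
  obtain ⟨bb, hbb⟩ := face_nonempty hBf hB0 (-h)
  have above : ∀ b ∈ B, b ∉ face B (-h) → lin h bb < lin h b := by
    intro b hb hn
    by_contra! hle
    refine hn ⟨hb, fun y hy => ?_⟩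
    have := hbb.2 y hy
    simp only [neg_lin] at this ⊢
    linarith
  have htSB : ∀ x ∈ SB, lin h x = lin h v₂ + lin h bb := by
    rintro _ ⟨b, hb, rfl⟩
    have := lin_eq_of_mem_face hb.1 hbb
    simp only [neg_lin] at this
    simp only [lin_add]
    linarith
  have htST : ∀ x ∈ ST, lin h x = lin h v₃ + lin h bt := by
    rintro _ ⟨b, hb, rfl⟩
    simp only [lin_add, lin_eq_of_mem_face hb.1.1 hbt]
  have htSL : ∀ x ∈ SL, lin h v₂ + lin h bb < lin h x := by
    rintro _ ⟨b, hb, rfl⟩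
    have := above b hb.1 hb.2.1
    simp only [lin_add]
    linarith
  have htSR : ∀ x ∈ SR, lin h v₂ + lin h bb < lin h x := by
    rintro _ ⟨b, hb, rfl⟩
    have := above b hb.1 hb.2.2.1
    simp only [lin_add]
    linarith
  have inSL : Set.InjOn (lin h) SL := by
    rintro _ ⟨b, hb, rfl⟩ _ ⟨b', hb', rfl⟩ he
    simp only [lin_add, add_right_inj] at he
    simp only [injOn_lin_chain_neg B hh hb hb' he]
  have inSR : Set.InjOn (lin h) SR := by
    rintro _ ⟨b, hb, rfl⟩ _ ⟨b', hb', rfl⟩ he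
    simp only [lin_add, add_right_inj] at he
    simp only [injOn_lin_chain B hh hb hb' he]
  -- lower bound for the union of one side, the bottom and possibly the top
  have side : ∀ S ⊆ I, Set.InjOn (lin h) S → (∀ x ∈ S, lin h v₂ + lin h bb < lin h x) →
      S.ncard + SB.ncard ≤ I.ncard ∧
      (lin h v₃ + lin h bt = lin h v₂ + lin h bb → S.ncard + ST.ncard ≤ I.ncard) ∧
      (lin h v₃ + lin h bt ≠ lin h v₂ + lin h bb →
        S.ncard + ST.ncard + SB.ncard ≤ I.ncard + 1) := by
    intro S hS hinj hlow
    have hSf := hIf.subset hS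
    have dSB : Disjoint S SB := Set.disjoint_left.2 fun x hx hx' => by
      have := hlow x hx; have := htSB x hx'; linarith
    refine ⟨?_, fun he => ?_, fun hne => ?_⟩
    · rw [← Set.ncard_union_eq dSB hSf (hIf.subset sSB)]
      exact Set.ncard_le_ncard (Set.union_subset hS sSB) hIf
    · have dST : Disjoint S ST := Set.disjoint_left.2 fun x hx hx' => by
        have := hlow x hx; have := htST x hx'; linarith
      rw [← Set.ncard_union_eq dST hSf (hIf.subset sST)]
      exact Set.ncard_le_ncard (Set.union_subset hS sST) hIf
    · have d : Disjoint (S ∪ ST) SB := by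
        refine Set.disjoint_left.2 fun x hx hx' => ?_
        rcases hx with hx | hx
        · exact Set.disjoint_left.1 dSB hx hx'
        · have := htST x hx; have := htSB x hx'; exact hne (by linarith)
      have e1 := Set.ncard_union_add_ncard_inter S ST hSf (hIf.subset sST)
      have e2 : (S ∩ ST).ncard ≤ 1 := by
        rw [Set.ncard_le_one (hSf.subset Set.inter_subset_left)]
        intro x hx y hy
        exact hinj hx.1 hy.1 ((htST x hx.2).trans (htST y hy.2).symm)
      have e3 := Set.ncard_union_eq d (hSf.union (hIf.subset sST)) (hIf.subset sSB)
      have e4 := Set.ncard_le_ncard (Set.union_subset (Set.union_subset hS sST) sSB) hIf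
      omega
  obtain ⟨l1, l2, l3⟩ := side SL sSL inSL htSL
  obtain ⟨r1, r2, r3⟩ := side SR sSR inSR htSR
  have cB := (ncard_eq_boundaryCount hB hBb).trans (boundaryCount_eq_chain hB hBf hh)
  have cT := ncard_innerFace hBf hB0 hh
  have cN := ncard_openFace hBf hB0 hnh
  -- Adding the bounds without the top for both sides, together with `hfew`, makes the top face of
  -- `B` exceed the bottom face by at least two. If the levels agreed, the bounds `l2` and `r2`
  -- would give the opposite inequality.
  have hne : lin h v₃ + lin h bt ≠ lin h v₂ + lin h bb := by
    intro he
    have := l2 he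
    have := r2 he
    omega
  have l4 := l3 hne
  have r4 := r3 hne
  -- Now the two faces have at most four points in total while the top one has at least two more
  -- than the bottom one. This forces sizes 3 and 1 and makes every estimate an equality.
  have eL : SL = I := Set.eq_of_subset_of_ncard_le sSL (by omega) hIf
  have eR : SR = I := Set.eq_of_subset_of_ncard_le sSR (by omega) hIf
  refine ⟨by omega, by omega, by omega, fun x hx => ⟨?_, ?_⟩, ?_⟩
  · rw [← eL] at hx
    obtain ⟨b, hb, rfl⟩ := hx
    simpa using hb
  · rw [← eR] at hx
    obtain ⟨b, hb, rfl⟩ := hx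
    simpa using hb
  · obtain ⟨b, hb⟩ : (innerFace B h).Nonempty := Set.nonempty_of_ncard_ne_zero (by omega)
    exact ⟨v₃ + b, sST ⟨b, hb, rfl⟩, by simpa using hb.1.1⟩

end Triangle

/-- A point of `B` exposed by two of the side normals of the triangle `v₁ v₂ v₃` is determined by
the middle points of the corresponding sides. -/
lemma eq_corner {B : Set Plane} {v₁ v₂ v₃ c b : Plane}
    (ho : lin (rot (v₂ - v₁)) (v₃ - v₁) < 0)
    (m₃ : c - v₃ ∈ face B (rot (v₂ - v₁))) (m₁ : c - v₁ ∈ face B (rot (v₃ - v₂)))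
    (h₁ : b ∈ face B (rot (v₂ - v₁))) (h₂ : b ∈ face B (rot (v₃ - v₂))) :
    b = (c - v₁ - v₂ - v₃) + (v₂ + v₂) := by
  refine eq_of_lin_eq (f := rot (v₂ - v₁)) (g := rot (v₃ - v₂)) ?_ ?_ ?_
  · have : lin (rot (v₂ - v₁)) (rot (rot (v₃ - v₂))) = -lin (rot (v₂ - v₁)) (v₃ - v₁) := by
      simp [lin]; ring
    rw [this]
    linarith
  · rw [lin_eq_of_mem_face h₁ m₃]; simp [lin]; ring
  · rw [lin_eq_of_mem_face h₂ m₁]; simp [lin]; ring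

/-- A common maximizer of `-f` and `-g` also maximizes their sum `k`, so every maximizer of `k`
maximizes `-f`: three points would fit into a one-point face. -/
lemma not_mem_face_neg_and_face_neg {B : Set Plane} {f g k b : Plane} (hsum : f + g + k = 0)
    (hf : (face B (-f)).ncard = 1) (hk : (face B k).ncard = 3) (h1 : b ∈ face B (-f))
    (h2 : b ∈ face B (-g)) : False := by
  have hlin : ∀ x, lin k x = lin (-f) x + lin (-g) x := by
    intro x
    rw [← add_lin, show k = -f + -g by rw [eq_comm, ← sub_eq_zero, ← neg_eq_zero, ← hsum]; abel]
  have hsub : face B k ⊆ face B (-f) := by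
    intro y hy
    have e1 := hy.2 b h1.1
    have e2 := h1.2 y hy.1
    have e3 := h2.2 y hy.1
    rw [hlin, hlin] at e1
    exact ⟨hy.1, fun z hz => (h1.2 z hz).trans (by linarith)⟩
  have := Set.ncard_le_ncard hsub (Set.finite_of_ncard_ne_zero (by omega))
  omega

lemma ncard_add_self_le (v₁ v₂ v₃ : Plane) :
    (({v₁, v₂, v₃} : Set Plane) + {v₁, v₂, v₃}).ncard ≤ 6 := by
  classical
  have : (({v₁, v₂, v₃} : Set Plane) + {v₁, v₂, v₃}) ⊆
      (({v₁ + v₁, v₂ + v₂, v₃ + v₃, v₁ + v₂, v₂ + v₃, v₃ + v₁} : Finset Plane) : Set Plane) := by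
    rintro _ ⟨a, ha, b, hb, rfl⟩
    simp only [Set.mem_insert_iff, Set.mem_singleton_iff] at ha hb
    rcases ha with rfl | rfl | rfl <;> rcases hb with rfl | rfl | rfl <;>
      simp [add_comm]
  refine (Set.ncard_le_ncard this (Finset.finite_toSet _)).trans ?_
  rw [Set.ncard_coe_finset]
  exact Finset.card_le_six

/-- The three sides together show that `A + B` has a single interior point `c`. The points `c - vᵢ`
are the side midpoints of the doubled triangle, and every other point of `B` is one of its corners;
the size 6 excludes a proper subset. -/
lemma exceptional_of_oriented {B : Set Plane} {v₁ v₂ v₃ : Plane}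
    (hA : ¬ Collinear ℝ ({v₁, v₂, v₃} : Set Plane)) (hB : ¬ Collinear ℝ B) (hBf : B.Finite)
    (hBb : ∀ x ∈ B, ∃ w, w ≠ 0 ∧ x ∈ face B w) (ho : lin (rot (v₂ - v₁)) (v₃ - v₁) < 0)
    (hfew : 2 * interiorCount ({v₁, v₂, v₃} + B) + 4 ≤ B.ncard) :
    (∃ t : Plane, B = t +ᵥ (({v₁, v₂, v₃} : Set Plane) + {v₁, v₂, v₃})) ∧ B.ncard = 6 ∧
      interiorCount ({v₁, v₂, v₃} + B) = 1 := by
  set A : Set Plane := {v₁, v₂, v₃} with hAdef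
  have hAf : A.Finite := Set.toFinite _
  have a₁ : v₁ ∈ A := by simp [hAdef]
  have a₂ : v₂ ∈ A := by simp [hAdef]
  have a₃ : v₃ ∈ A := by simp [hAdef]
  have ho₂ : lin (rot (v₃ - v₂)) (v₁ - v₂) < 0 := by
    have : lin (rot (v₃ - v₂)) (v₁ - v₂) = lin (rot (v₂ - v₁)) (v₃ - v₁) := by simp [lin]; ring
    rwa [this]
  have ho₃ : lin (rot (v₁ - v₃)) (v₂ - v₃) < 0 := by
    have : lin (rot (v₁ - v₃)) (v₂ - v₃) = lin (rot (v₂ - v₁)) (v₃ - v₁) := by simp [lin]; ring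
    rwa [this]
  set I := interiorSum A B with hI
  have key : ∀ {x y z : Plane}, x ∈ A → y ∈ A → z ∈ A → lin (rot (y - x)) (z - x) < 0 →
      rot (y - x) ≠ 0 ∧ (face B (rot (y - x))).ncard = 3 ∧ (face B (-rot (y - x))).ncard = 1 ∧
      B.ncard = 2 * I.ncard + 4 ∧
      (∀ p ∈ I, p - x ∈ chain B (-rot (y - x)) ∧ p - y ∈ chain B (rot (y - x))) ∧
      (∃ p ∈ I, p - z ∈ face B (rot (y - x))) ∧
      ∀ b ∈ B, b ∈ face B (rot (y - x)) ∨ b ∈ face B (-rot (y - x)) ∨ x + b ∈ I ∨ y + b ∈ I := by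
    intro x y z hx hy hz hlt
    have h0 : rot (y - x) ≠ 0 := ne_zero_of_lin_ne_zero hlt.ne
    have hr : rot (rot (y - x)) = x - y := by ext i; fin_cases i <;> simp
    have hlt' : lin (rot (y - x)) z < lin (rot (y - x)) y := by
      have e : lin (rot (y - x)) y = lin (rot (y - x)) x := by simp [lin]; ring
      rw [lin_sub] at hlt
      linarith
    obtain ⟨k1, k2, k3, k4, k5⟩ :=
      levels_of_few_interior hA hB hAf hBf hBb hx hy hz h0 hr hlt' hfew
    refine ⟨h0, k1, k2, k3, k4, k5, fun b hb => ?_⟩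
    by_cases c1 : b ∈ face B (rot (y - x))
    · exact Or.inl c1
    by_cases c2 : b ∈ face B (-rot (y - x))
    · exact Or.inr (Or.inl c2)
    rcases mem_chain_or h0 hb (hBb b hb) c1 c2 with c | c
    · exact Or.inr (Or.inr (Or.inr (add_chain_mem hA hB hx hy h0 hr c)))
    · exact Or.inr (Or.inr (Or.inl (add_chain_neg_mem hA hB hx hy h0 hr c)))
  obtain ⟨f0, f3, f1, fc, fI, fT, fB⟩ := key a₁ a₂ a₃ ho
  obtain ⟨g0, g3, g1, -, gI, gT, gB⟩ := key a₂ a₃ a₁ ho₂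
  obtain ⟨k0, k3, k1, -, kI, kT, kB⟩ := key a₃ a₁ a₂ ho₃
  -- The point `x - v₃` of `B` is above `x - v₁`, so it is not on the bottom face. Were it on a
  -- chain for this side, translating by `v₁` or `v₂` would give another point of `I` and place `x -
  -- v₃` on two opposite chains of another side.
  have top : ∀ x ∈ I, x - v₃ ∈ face B (rot (v₂ - v₁)) := by
    intro x hx
    rcases fB _ (chain_subset _ _ (gI x hx).2) with h | h | h | h
    · exact h
    · have := h.2 _ (chain_subset _ _ (fI x hx).1)
      simp only [neg_lin, lin_sub] at this ho
      linarith
    · have := (kI _ h).2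
      rw [add_sub_cancel_left] at this
      exact (Set.disjoint_left.1 (disjoint_chain hB k0) this (kI x hx).1).elim
    · have := (gI _ h).1
      rw [add_sub_cancel_left] at this
      exact (Set.disjoint_left.1 (disjoint_chain hB g0) (gI x hx).2 this).elim
  obtain ⟨c, hc, mf⟩ := fT
  -- By `top` the set `I` lies on one level, and its translate by `-v₁` lies in a chain, where
  -- levels are distinct.
  have hIc : ∀ x ∈ I, x = c := by
    intro x hx
    have e := lin_eq_of_mem_face (top x hx) (top c hc)
    have := injOn_lin_chain_neg B f0 (fI x hx).1 (fI c hc).1 (by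
      simp only [lin_sub] at e ⊢; linarith)
    simpa using this
  have hI1 : I = {c} := Set.eq_singleton_iff_unique_mem.2 ⟨hc, hIc⟩
  have hIcard : I.ncard = 1 := by rw [hI1, Set.ncard_singleton]
  have hBcard : B.ncard = 6 := by omega
  refine ⟨⟨c - v₁ - v₂ - v₃, ?_⟩, hBcard, hIcard⟩
  have mg : c - v₁ ∈ face B (rot (v₃ - v₂)) := by
    obtain ⟨x, hx, h⟩ := gT
    rwa [hIc x hx] at h
  have mk : c - v₂ ∈ face B (rot (v₁ - v₃)) := by
    obtain ⟨x, hx, h⟩ := kT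
    rwa [hIc x hx] at h
  have mem : ∀ {x y b : Plane}, x ∈ A → y ∈ A → b = (c - v₁ - v₂ - v₃) + (x + y) →
      b ∈ (c - v₁ - v₂ - v₃) +ᵥ (A + A) := by
    intro x y b hx hy hb
    rw [hb]
    exact Set.vadd_mem_vadd_set (Set.add_mem_add hx hy)
  refine Set.eq_of_subset_of_ncard_le (fun b hb => ?_) ?_ ((hAf.add hAf).image _)
  · by_cases e₁ : v₁ + b ∈ I
    · exact mem a₂ a₃ (by rw [← hIc _ e₁]; abel)
    by_cases e₂ : v₂ + b ∈ I
    · exact mem a₁ a₃ (by rw [← hIc _ e₂]; abel)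
    by_cases e₃ : v₃ + b ∈ I
    · exact mem a₁ a₂ (by rw [← hIc _ e₃]; abel)
    -- The remaining points are on the top or the bottom face for each of the three normals. Two
    -- tops determine a corner, two bottoms are impossible, and two of the three choices must agree.
    have F := (or_assoc.2 (fB b hb)).resolve_right (by tauto)
    have G := (or_assoc.2 (gB b hb)).resolve_right (by tauto)
    have K := (or_assoc.2 (kB b hb)).resolve_right (by tauto)
    have s₁ : rot (v₂ - v₁) + rot (v₃ - v₂) + rot (v₁ - v₃) = 0 := by
      ext i; fin_cases i <;> simp
    have s₂ : rot (v₃ - v₂) + rot (v₁ - v₃) + rot (v₂ - v₁) = 0 := by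
      rw [← s₁]; abel
    have s₃ : rot (v₁ - v₃) + rot (v₂ - v₁) + rot (v₃ - v₂) = 0 := by
      rw [← s₁]; abel
    rcases F with F | F
    · rcases G with G | G
      · exact mem a₂ a₂ (eq_corner ho mf mg F G)
      · rcases K with K | K
        · exact mem a₁ a₁ ((eq_corner ho₃ mk mf K F).trans (by abel))
        · exact (not_mem_face_neg_and_face_neg s₂ g1 f3 G K).elim
    · rcases G with G | G
      · rcases K with K | K
        · exact mem a₃ a₃ ((eq_corner ho₂ mg mk G K).trans (by abel))
        · exact (not_mem_face_neg_and_face_neg s₃ k1 g3 K F).elim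
      · exact (not_mem_face_neg_and_face_neg s₁ f1 k3 F G).elim
  · rw [hBcard]
    exact (Set.ncard_image_le (hAf.add hAf)).trans (ncard_add_self_le v₁ v₂ v₃)

/-- The exceptional pairs when one of the sets is a triangle. -/
lemma exceptional_of_ncard_eq_three {A B : Set Plane} (hA : ¬ Collinear ℝ A)
    (hB : ¬ Collinear ℝ B) (hBf : B.Finite) (hBb : ∀ x ∈ B, ∃ w, w ≠ 0 ∧ x ∈ face B w)
    (h3 : A.ncard = 3) (hfew : 2 * interiorCount (A + B) + 4 ≤ B.ncard) :
    (∃ t : Plane, B = t +ᵥ (A + A)) ∧ B.ncard = 6 ∧ interiorCount (A + B) = 1 := by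
  obtain ⟨x, y, z, hxy, hxz, hyz, rfl⟩ := Set.ncard_eq_three.1 h3
  have ho : lin (rot (y - x)) (z - x) ≠ 0 := by
    intro h0
    refine hA (collinear_iff_lin.2 ⟨_, rot_ne_zero (sub_ne_zero.2 hxy.symm), lin (rot (y - x)) x, ?_⟩)
    simp only [Set.mem_insert_iff, Set.mem_singleton_iff]
    rintro _ (rfl | rfl | rfl)
    · rfl
    · simp [lin]; ring
    · rw [lin_sub] at h0; linarith
  rcases lt_or_gt_of_ne ho with ho | ho
  · exact exceptional_of_oriented hA hB hBf hBb ho hfew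
  · have ho' : lin (rot (x - y)) (z - y) < 0 := by
      have : lin (rot (x - y)) (z - y) = -lin (rot (y - x)) (z - x) := by simp [lin]; ring
      rw [this]; linarith
    rw [Set.insert_comm] at hA hfew ⊢
    exact exceptional_of_oriented hA hB hBf hBb ho' hfew

/-! ### The number of triangles of a triangulation -/

/-- A point that is the unique minimizer of `h` in `s` is the unique point of the convex hull on
its level. -/
lemma eq_of_mem_convexHull_of_lin_eq {s : Set Plane} {h q z : Plane}
    (hs : ∀ y ∈ s, y = q ∨ lin h q < lin h y) (hz : z ∈ convexHull ℝ s)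
    (he : lin h z = lin h q) : z = q := by
  have hconv : Convex ℝ {x : Plane | x = q ∨ lin h q < lin h x} := by
    intro x hx y hy a b ha hb hab
    have hle : ∀ u : Plane, u = q ∨ lin h q < lin h u → lin h q ≤ lin h u := by
      rintro u (rfl | hu)
      · exact le_rfl
      · exact hu.le
    have h1 := mul_le_mul_of_nonneg_left (hle x hx) ha
    have h2 := mul_le_mul_of_nonneg_left (hle y hy) hb
    have h3 : (a + b) * lin h q = lin h q := by rw [hab, one_mul]
    rcases ha.eq_or_lt with rfl | ha'
    · rw [zero_add] at hab
      subst hab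
      simpa using hy
    rcases hb.eq_or_lt with rfl | hb'
    · rw [add_zero] at hab
      subst hab
      simpa using hx
    rcases hx with rfl | hx
    · rcases hy with rfl | hy
      · left
        rw [← add_smul, hab, one_smul]
      · right
        have := mul_lt_mul_of_pos_left hy hb'
        rw [lin_add, lin_smul, lin_smul]
        linarith
    · right
      have := mul_lt_mul_of_pos_left hx ha'
      rw [lin_add, lin_smul, lin_smul]
      linarith
  rcases convexHull_min hs hconv hz with h | h
  · exact h
  · exact absurd he h.ne'

/-- If `q` were lowest in `s`, it would be uniquely so, and the hull would meet the level of `q`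
only in `q`. -/
lemma exists_lin_lt_of_mem_convexHull {s : Set Plane} {h q d : Plane} {ε : ℝ}
    (hi : Set.InjOn (lin h) s) (hq : q ∈ s) (hε : 0 < ε) (hd : d ≠ 0) (hhd : lin h d = 0)
    (hz : q + ε • d ∈ convexHull ℝ s) : ∃ p ∈ s, lin h p < lin h q := by
  by_contra! hcon
  have := eq_of_mem_convexHull_of_lin_eq (h := h) (q := q) (fun y hy => ?_) hz
    (by rw [lin_add, lin_smul, hhd, mul_zero, add_zero])
  · rw [add_eq_left, smul_eq_zero] at this
    exact this.elim hε.ne' hd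
  · by_cases hyq : y = q
    · exact Or.inl hyq
    · exact Or.inr (lt_of_le_of_ne (hcon y hy) fun he => hyq (hi hy hq he.symm))

/-- If a horizontal ray from a vertex enters the convex hull of `s`, then `s` has both higher and
lower points. -/
lemma exists_lin_lt_lt_of_mem_convexHull {s : Set Plane} {h q d : Plane} {ε : ℝ}
    (hi : Set.InjOn (lin h) s) (hq : q ∈ s) (hε : 0 < ε) (hd : d ≠ 0) (hhd : lin h d = 0)
    (hz : q + ε • d ∈ convexHull ℝ s) :
    ∃ p ∈ s, ∃ r ∈ s, lin h p < lin h q ∧ lin h q < lin h r := by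
  obtain ⟨p, hp, hpq⟩ := exists_lin_lt_of_mem_convexHull hi hq hε hd hhd hz
  obtain ⟨r, hr, hrq⟩ := exists_lin_lt_of_mem_convexHull (injOn_lin_neg hi) hq hε hd
    (by rw [neg_lin, hhd, neg_zero]) hz
  simp only [neg_lin] at hrq
  exact ⟨p, hp, r, hr, hpq, by linarith⟩

/-- The points of `X` from which the ray in direction `d` enters the convex hull. -/
def enterSet (X : Set Plane) (d : Plane) : Set Plane :=
  {q | q ∈ X ∧ ∃ ε : ℝ, 0 < ε ∧ q + ε • d ∈ convexHull ℝ X}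

/-- The point at the level of `q` on a segment crossing that level. -/
lemma exists_mem_segment_level {h q a c : Plane} (hh : h ≠ 0)
    (hac : (lin h a - lin h q) * (lin h c - lin h q) < 0) :
    ∃ α β τ : ℝ, 0 < α ∧ 0 < β ∧ α + β = 1 ∧ α • a + β • c = q + τ • rot h := by
  have hne : lin h a - lin h c ≠ 0 := by
    intro h0
    rw [show lin h a = lin h c by linarith] at hac
    nlinarith [mul_self_nonneg (lin h c - lin h q)]
  have hα : 0 < (lin h q - lin h c) / (lin h a - lin h c) := by
    rcases mul_neg_iff.1 hac with ⟨h1, h2⟩ | ⟨h1, h2⟩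
    · exact div_pos (by linarith) (by linarith)
    · exact div_pos_of_neg_of_neg (by linarith) (by linarith)
  have hβ : 0 < (lin h a - lin h q) / (lin h a - lin h c) := by
    rcases mul_neg_iff.1 hac with ⟨h1, h2⟩ | ⟨h1, h2⟩
    · exact div_pos (by linarith) (by linarith)
    · exact div_pos_of_neg_of_neg (by linarith) (by linarith)
  set α := (lin h q - lin h c) / (lin h a - lin h c) with hαd
  set β := (lin h a - lin h q) / (lin h a - lin h c) with hβd
  have hsum : α + β = 1 := by rw [hαd, hβd, ← add_div, div_eq_one_iff_eq hne]; ring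
  obtain ⟨τ, hτ⟩ := exists_smul_rot (x := α • a + β • c - q) hh (by
    rw [lin_sub, lin_add, lin_smul, lin_smul]
    have e1 : α * (lin h a - lin h c) = lin h q - lin h c := div_mul_cancel₀ _ hne
    have e2 : β = 1 - α := by linarith
    rw [e2]
    linarith)
  exact ⟨α, β, τ, hα, hβ, hsum, by rw [← hτ]; abel⟩

/-- From a boundary point the ray enters the hull exactly when the supporting functionals there are
negative on the direction. The highest and lowest points drop out because they are alone on their
levels. -/
lemma enterSet_rot {X : Set Plane} (hX : ¬ Collinear ℝ X) {h : Plane} (hh : h ≠ 0)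
    (hi : Set.InjOn (lin h) X) :
    enterSet X (rot h) = (X ∩ interior (convexHull ℝ X)) ∪ chain X (-h) := by
  ext q
  constructor
  · rintro ⟨hq, ε, hε, hz⟩
    by_cases hint : q ∈ interior (convexHull ℝ X)
    · exact Or.inl ⟨hq, hint⟩
    right
    obtain ⟨p, hp, r, hr, hpq, hqr⟩ := exists_lin_lt_lt_of_mem_convexHull hi hq hε (rot_ne_zero hh)
      (lin_rot_self h) hz
    rw [mem_interior_convexHull_iff hX hq] at hint
    push Not at hint
    refine (mem_chain_or hh hq hint ?_ ?_).resolve_left ?_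
    · exact fun hf => absurd (hf.2 r hr) (not_le.2 hqr)
    · intro hf
      have := hf.2 p hp
      simp only [neg_lin] at this
      linarith
    · rintro ⟨-, -, -, f, hf, hfp⟩
      have := lin_le_of_mem_convexHull hf.2 hz
      rw [lin_add, lin_smul] at this
      have := mul_pos hε hfp
      linarith
  · rintro (⟨hq, hint⟩ | ⟨hq, h1, h2, f, hf, hfp⟩)
    · refine ⟨hq, ?_⟩
      have hcont : Filter.Tendsto (fun t : ℝ => q + t • rot h) (nhdsWithin 0 (Set.Ioi 0))
          (nhds q) := by
        have : Continuous (fun t : ℝ => q + t • rot h) := by fun_prop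
        have h2 := this.tendsto 0
        simp only [zero_smul, add_zero] at h2
        exact h2.mono_left nhdsWithin_le_nhds
      obtain ⟨t, ht, ht0⟩ :=
        ((hcont.eventually (isOpen_interior.mem_nhds hint)).and self_mem_nhdsWithin).exists
      exact ⟨t, ht0, interior_subset ht⟩
    · rw [neg_neg] at h2
      rw [lin_rot_neg] at hfp
      obtain ⟨c, hc, hcq⟩ :=
        exists_lin_lt hX (ne_zero_of_lin_ne_zero (by linarith : lin f (rot h) < 0).ne) hf
      have hne : lin h c ≠ lin h q := fun he => hcq.ne (by rw [hi hc hq he])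
      -- The point `c` is strictly inside the supporting half-plane, and `a` is taken on the other
      -- side of the level of `q`. The segment `a c` then crosses that level strictly inside the
      -- half-plane, hence on the ray in direction `rot h`.
      obtain ⟨a, ha, hac⟩ : ∃ a ∈ X, (lin h a - lin h q) * (lin h c - lin h q) < 0 := by
        rcases lt_or_gt_of_ne hne with hlt | hlt
        · obtain ⟨a, ha, haq⟩ : ∃ a ∈ X, lin h q < lin h a := by
            by_contra! hcon
            exact h2 ⟨hq, hcon⟩
          exact ⟨a, ha, mul_neg_of_pos_of_neg (by linarith) (by linarith)⟩
        · obtain ⟨a, ha, haq⟩ : ∃ a ∈ X, lin h a < lin h q := by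
            by_contra! hcon
            exact h1 ⟨hq, fun y hy => by simpa only [neg_lin, neg_le_neg_iff] using hcon y hy⟩
          exact ⟨a, ha, mul_neg_of_neg_of_pos (by linarith) (by linarith)⟩
      obtain ⟨α, β, τ, hα, hβ, hsum, hm⟩ := exists_mem_segment_level hh hac
      refine ⟨hq, τ, ?_, ?_⟩
      · have e := congrArg (lin f) hm
        simp only [lin_add, lin_smul] at e
        have e1 := mul_le_mul_of_nonneg_left (hf.2 a ha) hα.le
        have e2 := mul_lt_mul_of_pos_left hcq hβ
        have e3 : (α + β) * lin f q = lin f q := by rw [hsum, one_mul]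
        by_contra! hτ
        have := mul_nonneg (neg_nonneg.2 hτ) hfp.le
        linarith
      · rw [← hm]
        exact convex_convexHull ℝ X (subset_convexHull ℝ X ha) (subset_convexHull ℝ X hc) hα.le
          hβ.le hsum

/-- Counting horizontal directions that enter the convex hull. -/
lemma ncard_enterSet {X : Set Plane} (hX : ¬ Collinear ℝ X) (hfin : X.Finite) {h : Plane}
    (hh : h ≠ 0) (hi : Set.InjOn (lin h) X) :
    (enterSet X (rot h)).ncard + (enterSet X (-rot h)).ncard + 2 =
      2 * interiorCount X + boundaryCount X := by
  have hX0 := nonempty_of_not_collinear hX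
  have hIf : (X ∩ interior (convexHull ℝ X)).Finite := hfin.subset Set.inter_subset_left
  have key : ∀ k : Plane, Disjoint (X ∩ interior (convexHull ℝ X)) (chain X k) := by
    intro k
    rw [Set.disjoint_left]
    rintro x ⟨hx, hint⟩ ⟨-, -, -, f, hf, hfp⟩
    exact (mem_interior_convexHull_iff hX hx).1 hint f (ne_zero_of_lin_ne_zero hfp.ne') hf
  have e := boundaryCount_eq_chain hX hfin hh
  rw [ncard_face_of_injOn hfin hX0 hi, ncard_face_of_injOn hfin hX0 (injOn_lin_neg hi)] at e
  rw [← rot_neg, enterSet_rot hX hh hi, enterSet_rot hX (neg_ne_zero.2 hh) (injOn_lin_neg hi),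
    neg_neg, Set.ncard_union_eq (key _) hIf (hfin.subset (chain_subset X _)),
    Set.ncard_union_eq (key _) hIf (hfin.subset (chain_subset X _)), e, interiorCount]
  omega

/-! ### Matching triangles with entering horizontal rays -/

section Complex

variable {X : Set Plane} {K : Geometry.SimplicialComplex ℝ Plane}

lemma face_coe_subset (hK : IsTriangulation X K) {s : Finset Plane} (hs : s ∈ K.faces) :
    (s : Set Plane) ⊆ X := by
  rw [← hK.1, K.vertices_eq]
  exact Set.subset_biUnion_of_mem (u := fun k : Finset Plane => (k : Set Plane)) hs

lemma card_face_le {s : Finset Plane} (hs : s ∈ K.faces) : s.card ≤ 3 := by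
  have h1 := (K.indep hs).card_le_finrank_succ
  have h2 := Submodule.finrank_le (vectorSpan ℝ (Set.range ((↑) : s → Plane)))
  have h3 : Module.finrank ℝ Plane = 2 := by simp
  rw [Fintype.card_coe] at h1
  omega

/-- Used to see that a face containing an initial piece of a horizontal ray from one of its vertices
is a triangle with that vertex in the middle. -/
lemma finset_eq_of_lt {h : Plane} {s : Finset Plane} (hs : s.card ≤ 3) {p q r : Plane} (hp : p ∈ s)
    (hq : q ∈ s) (hr : r ∈ s) (hpq : lin h p < lin h q) (hqr : lin h q < lin h r) :
    s = {p, q, r} ∧ s.card = 3 := by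
  classical
  have h1 : p ≠ q := by rintro rfl; exact lt_irrefl _ hpq
  have h2 : q ≠ r := by rintro rfl; exact lt_irrefl _ hqr
  have h3 : p ≠ r := by rintro rfl; exact lt_asymm hpq hqr
  have h4 : ({p, q, r} : Finset Plane).card = 3 := Finset.card_eq_three.2 ⟨p, q, r, h1, h3, h2, rfl⟩
  have h5 : ({p, q, r} : Finset Plane) ⊆ s := by
    intro x hx
    simp only [Finset.mem_insert, Finset.mem_singleton] at hx
    rcases hx with rfl | rfl | rfl <;> assumption
  have h6 := Finset.eq_of_subset_of_card_le h5 (by omega)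
  exact ⟨h6.symm, by rw [← h6, h4]⟩

lemma not_mem_convexHull_pair {p q r : Plane} (hK : ({p, q, r} : Finset Plane) ∈ K.faces)
    (hpq : p ≠ q) (hqr : q ≠ r) : q ∉ convexHull ℝ ({p, r} : Set Plane) := by
  classical
  have h1 : ({p, r} : Finset Plane) ∈ K.faces := by
    refine K.down_closed hK (fun x hx => ?_) ⟨p, by simp⟩
    simp only [Finset.mem_insert, Finset.mem_singleton] at hx ⊢
    tauto
  have h2 : q ∈ K.vertices := by
    refine Geometry.SimplicialComplex.mem_vertices.2 (K.down_closed hK ?_ ⟨q, by simp⟩)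
    simp
  intro hq
  have := (Geometry.SimplicialComplex.vertex_mem_convexHull_iff h2 h1).1 (by simpa using hq)
  simp only [Finset.mem_insert, Finset.mem_singleton] at this
  rcases this with rfl | rfl
  · exact hpq rfl
  · exact hqr rfl

/-- A triangle contains a horizontal ray from its middle vertex. -/
lemma exists_enter_of_triangle (hK : IsTriangulation X K) {h : Plane} (hh : h ≠ 0)
    (hi : Set.InjOn (lin h) X) {t : Finset Plane} (ht : t ∈ K.faces) (h3 : t.card = 3) :
    ∃ q ∈ t, ∃ d, (d = rot h ∨ d = -rot h) ∧
      ∃ ε : ℝ, 0 < ε ∧ q + ε • d ∈ convexHull ℝ (t : Set Plane) := by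
  classical
  have hit := hi.mono (face_coe_subset hK ht)
  obtain ⟨p, hp, hpmin⟩ := t.exists_min_image (lin h) (Finset.card_pos.1 (by omega))
  obtain ⟨r, hr, hrmax⟩ := t.exists_max_image (lin h) (Finset.card_pos.1 (by omega))
  obtain ⟨q, hq, hqn⟩ : ∃ q ∈ t, q ∉ ({p, r} : Finset Plane) := by
    by_contra! hcon
    have := Finset.card_le_card (show t ⊆ {p, r} from hcon)
    have := Finset.card_le_two (a := p) (b := r)
    omega
  simp only [Finset.mem_insert, Finset.mem_singleton, not_or] at hqn
  have hpq : lin h p < lin h q :=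
    lt_of_le_of_ne (hpmin q hq) fun he => hqn.1 (hit hq hp he.symm)
  have hqr : lin h q < lin h r :=
    lt_of_le_of_ne (hrmax q hq) fun he => hqn.2 (hit hq hr he)
  obtain ⟨α, β, τ, hα, hβ, hsum, hm⟩ := exists_mem_segment_level (q := q) (a := p) (c := r) hh
    (mul_neg_of_neg_of_pos (by linarith) (by linarith))
  have hmem : ∀ s : Set Plane, p ∈ s → r ∈ s → q + τ • rot h ∈ convexHull ℝ s := by
    intro s hps hrs
    rw [← hm]
    exact convex_convexHull ℝ s (subset_convexHull ℝ s hps) (subset_convexHull ℝ s hrs) hα.le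
      hβ.le hsum
  have hτ : τ ≠ 0 := by
    rintro rfl
    have ht' := (finset_eq_of_lt (h := h) h3.le hp hq hr hpq hqr).1
    rw [ht'] at ht
    refine not_mem_convexHull_pair ht (Ne.symm hqn.1) hqn.2 ?_
    simpa using hmem {p, r} (by simp) (by simp)
  rcases lt_or_gt_of_ne hτ with hneg | hpos
  · exact ⟨q, hq, -rot h, Or.inr rfl, -τ, by linarith, by simpa using hmem t hp hr⟩
  · exact ⟨q, hq, rot h, Or.inl rfl, τ, hpos, hmem t hp hr⟩

/-- The horizontal ray of a triangle is unique. -/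
lemma enter_unique (hK : IsTriangulation X K) {h : Plane} (hh : h ≠ 0)
    (hi : Set.InjOn (lin h) X) {t : Finset Plane} (ht : t ∈ K.faces) {q q' d d' : Plane}
    {ε ε' : ℝ} (hq : q ∈ t) (hq' : q' ∈ t) (hd : d = rot h ∨ d = -rot h)
    (hd' : d' = rot h ∨ d' = -rot h) (hε : 0 < ε) (hε' : 0 < ε')
    (hz : q + ε • d ∈ convexHull ℝ (t : Set Plane))
    (hz' : q' + ε' • d' ∈ convexHull ℝ (t : Set Plane)) : q = q' ∧ d = d' := by
  have hit := hi.mono (face_coe_subset hK ht)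
  have hdp : ∀ d : Plane, d = rot h ∨ d = -rot h → d ≠ 0 ∧ lin h d = 0 := by
    rintro d (rfl | rfl)
    · exact ⟨rot_ne_zero hh, lin_rot_self h⟩
    · exact ⟨neg_ne_zero.2 (rot_ne_zero hh), by rw [← rot_neg, lin_rot_neg, lin_rot_self, neg_zero]⟩
  obtain ⟨p, hp, r, hr, hpq, hqr⟩ :=
    exists_lin_lt_lt_of_mem_convexHull hit hq hε (hdp d hd).1 (hdp d hd).2 hz
  obtain ⟨p', hp', r', hr', hpq', hqr'⟩ :=
    exists_lin_lt_lt_of_mem_convexHull hit hq' hε' (hdp d' hd').1 (hdp d' hd').2 hz'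
  have hteq := (finset_eq_of_lt (h := h) (card_face_le ht) hp hq hr hpq hqr).1
  have hqq : q = q' := by
    have memt : ∀ x, x ∈ t → x = p ∨ x = q ∨ x = r := fun x hx => by
      rw [hteq] at hx; simpa using hx
    rcases memt q' hq' with rfl | rfl | rfl
    · rcases memt p' hp' with rfl | rfl | rfl <;> linarith
    · rfl
    · rcases memt r' hr' with rfl | rfl | rfl <;> linarith
  refine ⟨hqq, ?_⟩
  subst hqq
  by_contra hne
  have hdd : d' = -d := by
    rcases hd with rfl | rfl <;> rcases hd' with rfl | rfl <;> simp_all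
  subst hdd
  rw [hteq] at ht
  have hnpq : p ≠ q := by rintro rfl; exact lt_irrefl _ hpq
  have hnqr : q ≠ r := by rintro rfl; exact lt_irrefl _ hqr
  have hnpr : r - p ≠ 0 := by
    intro h0; rw [sub_eq_zero.1 h0] at hqr; exact lt_asymm hpq hqr
  -- A normal of the side `p r`, signed so that `q` is its strict maximizer on the triangle. If both
  -- opposite rays entered, `f` would vanish on `d`, and the hull would meet the maximal level of
  -- `f` in more than `q`.
  obtain ⟨f, hf1, hf2⟩ : ∃ f, lin f p < lin f q ∧ lin f r < lin f q := by
    have e1 : lin (rot (r - p)) r = lin (rot (r - p)) p := by simp [lin]; ring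
    rcases lt_trichotomy (lin (rot (r - p)) p) (lin (rot (r - p)) q) with hlt | heq | hlt
    · exact ⟨_, hlt, by rwa [e1]⟩
    · exfalso
      obtain ⟨c, hc⟩ := exists_smul_rot (x := q - p) (rot_ne_zero hnpr) (by
        rw [lin_sub, heq, sub_self])
      rw [show rot (rot (r - p)) = p - r by ext i; fin_cases i <;> simp] at hc
      have e2 := congrArg (lin h) hc
      rw [lin_sub, lin_smul, lin_sub] at e2
      have hc0 : c < 0 := by
        by_contra! hc0
        have := mul_nonneg hc0 (by linarith : 0 ≤ lin h r - lin h p)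
        linarith
      have hc1 : -1 < c := by
        by_contra! hc1
        have := mul_nonneg (by linarith : 0 ≤ -1 - c) (by linarith : 0 ≤ lin h r - lin h p)
        linarith
      refine not_mem_convexHull_pair ht hnpq hnqr ?_
      have : q = (1 + c) • p + (-c) • r := by
        rw [← sub_add_cancel q p, hc]; module
      rw [this]
      exact convex_convexHull ℝ _ (subset_convexHull ℝ _ (by simp))
        (subset_convexHull ℝ _ (by simp)) (by linarith) (by linarith) (by ring)
    · exact ⟨-rot (r - p), by simpa only [neg_lin, neg_lt_neg_iff] using hlt,
        by simpa only [neg_lin, neg_lt_neg_iff, e1] using hlt⟩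
  have hle : ∀ y ∈ (t : Set Plane), lin f y ≤ lin f q := by
    intro y hy
    rw [hteq] at hy
    simp only [Finset.coe_insert, Finset.coe_singleton, Set.mem_insert_iff,
      Set.mem_singleton_iff] at hy
    rcases hy with rfl | rfl | rfl <;> linarith
  have l1 := lin_le_of_mem_convexHull hle hz
  have l2 := lin_le_of_mem_convexHull hle hz'
  have hfd : lin f d = 0 := by
    rw [lin_add, lin_smul] at l1 l2
    rw [show lin f (-d) = -lin f d by simp [lin]; ring] at l2
    have a1 : lin f d ≤ 0 := by
      by_contra! h0
      have := mul_pos hε h0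
      linarith
    have a2 : 0 ≤ lin f d := by
      by_contra! h0
      have := mul_pos hε' (neg_pos.2 h0)
      linarith
    exact le_antisymm a1 a2
  have := eq_of_mem_convexHull_of_lin_eq (h := -f) (q := q) (fun y hy => ?_) hz
    (by simp only [neg_lin, lin_add, lin_smul, hfd]; ring)
  · rw [add_eq_left, smul_eq_zero] at this
    exact this.elim hε.ne' (hdp d hd).1
  · rw [hteq] at hy
    simp only [Finset.coe_insert, Finset.coe_singleton, Set.mem_insert_iff,
      Set.mem_singleton_iff] at hy
    simp only [neg_lin, neg_lt_neg_iff]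
    rcases hy with rfl | rfl | rfl
    · exact Or.inr hf1
    · exact Or.inl rfl
    · exact Or.inr hf2

/-- A horizontal ray entering the convex hull starts in some triangle. -/
lemma exists_triangle_of_enter (hfin : X.Finite) (hK : IsTriangulation X K) {h : Plane}
    (hi : Set.InjOn (lin h) X) {q d : Plane} (hd0 : d ≠ 0) (hhd : lin h d = 0)
    (hq : q ∈ enterSet X d) : ∃ t ∈ K.faces, t.card = 3 ∧ q ∈ t ∧
      ∃ ε : ℝ, 0 < ε ∧ q + ε • d ∈ convexHull ℝ (t : Set Plane) := by
  obtain ⟨hqX, ε, hε, hz⟩ := hq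
  have hFf : K.faces.Finite := by
    refine (hfin.toFinset.powerset.finite_toSet).subset fun s hs => ?_
    simp only [Finset.coe_powerset, Set.mem_preimage, Set.mem_powerset_iff, Set.Finite.coe_toFinset]
    exact face_coe_subset hK hs
  -- The finitely many faces whose hulls miss `q` stay away from a neighbourhood of `q`, so a short
  -- piece of the ray lies only in faces having `q` as a vertex.
  have hcl : IsClosed (⋃ s ∈ {s ∈ K.faces | q ∉ convexHull ℝ (s : Set Plane)},
      convexHull ℝ (s : Set Plane)) :=
    (hFf.subset fun s hs => hs.1).isClosed_biUnion fun s _ =>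
      (s.finite_toSet.isCompact_convexHull ℝ).isClosed
  have hcont : Filter.Tendsto (fun t : ℝ => q + t • d) (nhdsWithin 0 (Set.Ioi 0)) (nhds q) := by
    have : Continuous (fun t : ℝ => q + t • d) := by fun_prop
    have h2 := this.tendsto 0
    simp only [zero_smul, add_zero] at h2
    exact h2.mono_left nhdsWithin_le_nhds
  have hqn : q ∉ ⋃ s ∈ {s ∈ K.faces | q ∉ convexHull ℝ (s : Set Plane)},
      convexHull ℝ (s : Set Plane) := by
    simp only [Set.mem_iUnion, not_exists]
    exact fun s hs hqs => hs.2 hqs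
  obtain ⟨δ, hδ, hδ0, hδε⟩ := ((hcont.eventually (hcl.isOpen_compl.mem_nhds hqn)).and
    (Ioc_mem_nhdsGT hε)).exists
  have hzδ : q + δ • d ∈ K.space := by
    rw [hK.2]
    have hc := (convex_convexHull ℝ X).add_smul_mem (subset_convexHull ℝ X hqX) hz
      (t := δ / ε) ⟨by positivity, (div_le_one hε).2 hδε⟩
    rwa [smul_smul, div_mul_cancel₀ _ hε.ne'] at hc
  obtain ⟨s, hs, hzs⟩ := Geometry.SimplicialComplex.mem_space_iff.1 hzδ
  have hqs : q ∈ convexHull ℝ (s : Set Plane) := by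
    by_contra hcon
    exact hδ (Set.mem_biUnion (show s ∈ {s ∈ K.faces | q ∉ convexHull ℝ (s : Set Plane)} from
      ⟨hs, hcon⟩) hzs)
  have hqs' : q ∈ s :=
    (Geometry.SimplicialComplex.vertex_mem_convexHull_iff (hK.1 ▸ hqX) hs).1 hqs
  obtain ⟨p, hp, r, hr, hpq, hqr⟩ := exists_lin_lt_lt_of_mem_convexHull
    (hi.mono (face_coe_subset hK hs)) hqs' hδ0 hd0 hhd hzs
  exact ⟨s, hs, (finset_eq_of_lt (card_face_le hs) hp hqs' hr hpq hqr).2, hqs', δ, hδ0, hzs⟩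

/-- A horizontal ray starts in at most one triangle. -/
lemma triangle_unique (hK : IsTriangulation X K) {h : Plane}
    (hi : Set.InjOn (lin h) X) {q d : Plane} (hd0 : d ≠ 0) (hhd : lin h d = 0)
    {t t' : Finset Plane} (ht : t ∈ K.faces) (ht' : t' ∈ K.faces) (hq : q ∈ t) (hq' : q ∈ t')
    {ε ε' : ℝ} (hε : 0 < ε) (hε' : 0 < ε') (hz : q + ε • d ∈ convexHull ℝ (t : Set Plane))
    (hz' : q + ε' • d ∈ convexHull ℝ (t' : Set Plane)) : t = t' := by
  have shrink : ∀ {s : Finset Plane} {η : ℝ}, q ∈ s → 0 < η →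
      q + η • d ∈ convexHull ℝ (s : Set Plane) → min ε ε' ≤ η →
      q + min ε ε' • d ∈ convexHull ℝ (s : Set Plane) := by
    intro s η hqs hη hzs hle
    have hc := (convex_convexHull ℝ (s : Set Plane)).add_smul_mem (subset_convexHull ℝ _ hqs) hzs
      (t := min ε ε' / η) ⟨by positivity, (div_le_one hη).2 hle⟩
    rwa [smul_smul, div_mul_cancel₀ _ hη.ne'] at hc
  -- A common short piece of both rays lies in the hull of the shared vertices. These then include a
  -- vertex below `q` and one above it, which determine both faces.
  have hmem := K.inter_subset_convexHull ht ht' ⟨shrink hq hε hz (min_le_left _ _),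
    shrink hq' hε' hz' (min_le_right _ _)⟩
  obtain ⟨p, hp, r, hr, hpq, hqr⟩ := exists_lin_lt_lt_of_mem_convexHull
    (hi.mono (Set.inter_subset_left.trans (face_coe_subset hK ht))) ⟨hq, hq'⟩
    (lt_min hε hε') hd0 hhd hmem
  rw [(finset_eq_of_lt (card_face_le ht) hp.1 hq hr.1 hpq hqr).1,
    (finset_eq_of_lt (card_face_le ht') hp.2 hq' hr.2 hpq hqr).1]

/-- The number of triangles of a triangulation. -/
theorem triangleCount_add_two (hX : ¬ Collinear ℝ X) (hfin : X.Finite)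
    (hK : IsTriangulation X K) :
    triangleCount K + 2 = 2 * interiorCount X + boundaryCount X := by
  obtain ⟨h, hh, hi⟩ := exists_injOn_lin hfin
  have hr0 := rot_ne_zero hh
  rw [← ncard_enterSet hX hfin hh hi]
  congr 1
  have hdp : ∀ d : Plane, d = rot h ∨ d = -rot h → d ≠ 0 ∧ lin h d = 0 := by
    rintro d (rfl | rfl)
    · exact ⟨hr0, lin_rot_self h⟩
    · exact ⟨neg_ne_zero.2 hr0, by rw [← rot_neg, lin_rot_neg, lin_rot_self, neg_zero]⟩
  have hEf : ∀ d, (enterSet X d).Finite := fun d => hfin.subset fun q hq => hq.1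
  have hne : rot h ≠ -rot h := by
    intro he
    have h2 : (2 : ℝ) • rot h = 0 := by
      rw [two_smul]
      exact add_eq_zero_iff_eq_neg.2 he
    exact hr0 ((smul_eq_zero.1 h2).resolve_left two_ne_zero)
  have hcard : (enterSet X (rot h) ×ˢ {rot h} ∪ enterSet X (-rot h) ×ˢ {-rot h}).ncard =
      (enterSet X (rot h)).ncard + (enterSet X (-rot h)).ncard := by
    rw [Set.ncard_union_eq _ ((hEf _).prod (Set.finite_singleton _))
      ((hEf _).prod (Set.finite_singleton _)), Set.ncard_prod, Set.ncard_prod,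
      Set.ncard_singleton, Set.ncard_singleton, mul_one, mul_one]
    rw [Set.disjoint_left]
    rintro ⟨q, d⟩ ⟨-, h1⟩ ⟨-, h2⟩
    exact hne (h1.symm.trans h2)
  rw [← hcard, triangleCount]
  have hmemS : ∀ q d, (q, d) ∈ enterSet X (rot h) ×ˢ {rot h} ∪ enterSet X (-rot h) ×ˢ {-rot h} ↔
      (d = rot h ∨ d = -rot h) ∧ q ∈ enterSet X d := by
    intro q d
    constructor
    · rintro (⟨h1, h2⟩ | ⟨h1, h2⟩) <;> simp only [Set.mem_singleton_iff] at h1 h2 <;> subst h2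
      · exact ⟨Or.inl rfl, h1⟩
      · exact ⟨Or.inr rfl, h1⟩
    · rintro ⟨rfl | rfl, h1⟩
      · exact Or.inl ⟨h1, rfl⟩
      · exact Or.inr ⟨h1, rfl⟩
  symm
  have hex : ∀ x ∈ enterSet X (rot h) ×ˢ {rot h} ∪ enterSet X (-rot h) ×ˢ {-rot h},
      ∃ t ∈ K.faces, t.card = 3 ∧ x.1 ∈ t ∧
        ∃ ε : ℝ, 0 < ε ∧ x.1 + ε • x.2 ∈ convexHull ℝ (t : Set Plane) := by
    rintro ⟨q, d⟩ hx
    obtain ⟨hd, hq⟩ := (hmemS q d).1 hx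
    exact exists_triangle_of_enter hfin hK hi (hdp d hd).1 (hdp d hd).2 hq
  choose F hF1 hF2 hF3 E hE hF4 using hex
  refine Set.ncard_congr F (fun x hx => ⟨hF1 x hx, hF2 x hx⟩) ?_ ?_
  · rintro ⟨q, d⟩ ⟨q', d'⟩ hx hx' heq
    have h3' := hF3 _ hx'
    have h4' := hF4 _ hx'
    rw [← heq] at h3' h4'
    obtain ⟨rfl, rfl⟩ := enter_unique hK hh hi (hF1 _ hx) (hF3 _ hx) h3' ((hmemS q d).1 hx).1
      ((hmemS q' d').1 hx').1 (hE _ hx) (hE _ hx') (hF4 _ hx) h4'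
    rfl
  · rintro t ⟨ht, h3⟩
    obtain ⟨q, hq, d, hd, ε, hε, hz⟩ := exists_enter_of_triangle hK hh hi ht h3
    have hx := (hmemS q d).2 ⟨hd, face_coe_subset hK ht hq, ε, hε,
      convexHull_mono (face_coe_subset hK ht) hz⟩
    exact ⟨(q, d), hx, triangle_unique hK hi (hdp d hd).1 (hdp d hd).2 (hF1 _ hx) ht (hF3 _ hx) hq
      (hE _ hx) hε (hF4 _ hx) hz⟩

end Complex

/-! ### The main theorem -/

lemma three_le_ncard {X : Set Plane} (hX : ¬ Collinear ℝ X) (hfin : X.Finite) : 3 ≤ X.ncard := by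
  by_contra! hlt
  have h0 : X.ncard ≠ 0 := ((Set.ncard_pos hfin).2 (nonempty_of_not_collinear hX)).ne'
  obtain h1 | h2 : X.ncard = 1 ∨ X.ncard = 2 := by omega
  · obtain ⟨x, rfl⟩ := Set.ncard_eq_one.1 h1
    exact hX (collinear_singleton ℝ x)
  · obtain ⟨x, y, -, rfl⟩ := Set.ncard_eq_two.1 h2
    exact hX (collinear_pair ℝ x y)

lemma inter_frontier_eq_of_ncard_eq {X : Set Plane} (hfin : X.Finite)
    (h : X.ncard = boundaryCount X) : X ∩ frontier (convexHull ℝ X) = X :=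
  Set.eq_of_subset_of_ncard_le Set.inter_subset_left h.le hfin

lemma exists_mem_face_of_ncard_eq {X : Set Plane} (hX : ¬ Collinear ℝ X) (hfin : X.Finite)
    (h : X.ncard = boundaryCount X) : ∀ x ∈ X, ∃ w, w ≠ 0 ∧ x ∈ face X w := by
  intro x hx
  rw [← inter_frontier_eq_of_ncard_eq hfin h] at hx
  exact (mem_frontier_convexHull_iff hX hx.1).1 hx.2

lemma interiorCount_eq_zero_of_ncard_eq {X : Set Plane} (hfin : X.Finite)
    (h : X.ncard = boundaryCount X) : interiorCount X = 0 := by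
  have : X ∩ interior (convexHull ℝ X) = ∅ := by
    refine Set.eq_empty_of_forall_notMem fun x hx => ?_
    have hf : x ∈ X ∩ frontier (convexHull ℝ X) := (inter_frontier_eq_of_ncard_eq hfin h).symm ▸ hx.1
    exact Set.disjoint_left.1 disjoint_interior_frontier hx.2 hf.2
  rw [interiorCount, this, Set.ncard_empty]

/-- Either there are many interior points, or one of the sets is a triangle and the other one
is a translate of its double. -/
lemma many_interior_or_exceptional {A B : Set Plane} (hA : A.Finite) (hB : B.Finite)
    (hAc : ¬ Collinear ℝ A) (hBc : ¬ Collinear ℝ B) (hAb : A.ncard = boundaryCount A)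
    (hBb : B.ncard = boundaryCount B) :
    A.ncard + B.ncard ≤ 2 * interiorCount (A + B) + 6 ∨
    (A.ncard = 3 ∧ (∃ t : Plane, B = t +ᵥ (A + A)) ∧ B.ncard = 6 ∧ interiorCount (A + B) = 1) ∨
    (B.ncard = 3 ∧ (∃ t : Plane, A = t +ᵥ (B + B)) ∧ A.ncard = 6 ∧ interiorCount (A + B) = 1) := by
  have fA := exists_mem_face_of_ncard_eq hAc hA hAb
  have fB := exists_mem_face_of_ncard_eq hBc hB hBb
  have nA := three_le_ncard hAc hA
  have nB := three_le_ncard hBc hB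
  by_cases hfew : A.ncard + B.ncard ≤ 2 * interiorCount (A + B) + 6
  · exact Or.inl hfew
  right
  rcases nA.eq_or_lt with hA3 | hA4
  · exact Or.inl ⟨hA3.symm,
      exceptional_of_ncard_eq_three hAc hBc hB fB hA3.symm (by omega)⟩
  rcases nB.eq_or_lt with hB3 | hB4
  · rw [add_comm A B] at hfew ⊢
    exact Or.inr ⟨hB3.symm,
      exceptional_of_ncard_eq_three hBc hAc hA fA hB3.symm (by omega)⟩
  exfalso
  rcases le_total A.ncard B.ncard with hle | hle
  · exact hfew (interiorCount_ge_of_four_le hAc hBc hA hB fA fB hA4 hle)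
  · have := interiorCount_ge_of_four_le hBc hAc hB hA fB fA hB4 hle
    rw [add_comm A B] at hfew
    omega

lemma sqrt_add_sqrt_le {x y z : ℝ} (hx : 0 ≤ x) (hy : 0 ≤ y) (hz : 2 * (x + y) ≤ z) :
    √x + √y ≤ √z := by
  apply Real.le_sqrt_of_sq_le
  nlinarith [sq_nonneg (√x - √y), Real.sq_sqrt hx, Real.sq_sqrt hy]

lemma one_add_two_le_sqrt {z : ℝ} (hz : 9 ≤ z) : √1 + √4 ≤ √z := by
  apply Real.le_sqrt_of_sq_le
  rw [Real.sqrt_one, show (4 : ℝ) = 2 ^ 2 by norm_num, Real.sqrt_sq (by norm_num)]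
  linarith

theorem theorem3 (A B : Set Plane) (hA : A.Finite) (hB : B.Finite)
    (hAc : ¬ Collinear ℝ A) (hBc : ¬ Collinear ℝ B)
    (hAb : A.ncard = boundaryCount A) (hBb : B.ncard = boundaryCount B) :
    -- if `2 i_{A+B} ≥ b_A + b_B - 6` fails, then `A, B` is an exceptional pair
    (¬ (2 * (interiorCount (A + B) : ℤ) ≥ boundaryCount A + boundaryCount B - 6) →
      (A.ncard = 3 ∧ ∃ t : Plane, B = t +ᵥ (A + A)) ∨
      (B.ncard = 3 ∧ ∃ t : Plane, A = t +ᵥ (B + B))) ∧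
    -- the conjectured inequality in terms of boundary and interior points
    √(2 * (interiorCount (A + B) : ℝ) + boundaryCount (A + B) - 2) ≥
      √(2 * (interiorCount A : ℝ) + boundaryCount A - 2) +
        √(2 * (interiorCount B : ℝ) + boundaryCount B - 2) ∧
    -- the conjectured inequality in terms of the number of triangles in any triangulations
    (∀ KA KB KAB : Geometry.SimplicialComplex ℝ Plane,
      IsTriangulation A KA → IsTriangulation B KB → IsTriangulation (A + B) KAB →
      √(triangleCount KAB : ℝ) ≥ √(triangleCount KA : ℝ) + √(triangleCount KB : ℝ)) := by
  have hcases := many_interior_or_exceptional hA hB hAc hBc hAb hBb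
  have hsqrt : √(2 * (interiorCount (A + B) : ℝ) + boundaryCount (A + B) - 2) ≥
      √(2 * (interiorCount A : ℝ) + boundaryCount A - 2) +
        √(2 * (interiorCount B : ℝ) + boundaryCount B - 2) := by
    have hbd : (boundaryCount A : ℝ) + boundaryCount B ≤ boundaryCount (A + B) := by
      exact_mod_cast boundaryCount_add_le hA hB hAc hBc
    rw [interiorCount_eq_zero_of_ncard_eq hA hAb, interiorCount_eq_zero_of_ncard_eq hB hBb]
    have nA : (3 : ℝ) ≤ boundaryCount A := by exact_mod_cast hAb ▸ three_le_ncard hAc hA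
    have nB : (3 : ℝ) ≤ boundaryCount B := by exact_mod_cast hBb ▸ three_le_ncard hBc hB
    rw [hAb, hBb] at hcases
    rcases hcases with hmany | ⟨h3, -, h6, h1⟩ | ⟨h3, -, h6, h1⟩
    · have hm : (boundaryCount A : ℝ) + boundaryCount B ≤ 2 * interiorCount (A + B) + 6 := by
        exact_mod_cast hmany
      -- The hypothesis `2 (x + y) ≤ z` holds because `(b_A + b_B - 6) + (b_A + b_B) - 2 = 2 ((b_A -
      -- 2) + (b_B - 2))`.
      apply sqrt_add_sqrt_le <;> push_cast <;> linarith
    -- With sizes 3 and 6 and one interior point, the count for the sumset is at least `2 + 9 - 2 =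
    -- 9`, against 1 and 4.
    · rw [h3, h6] at hbd ⊢
      rw [h1]
      push_cast at hbd ⊢
      convert one_add_two_le_sqrt _ using 3 <;> linarith
    · rw [h3, h6] at hbd ⊢
      rw [h1]
      push_cast at hbd ⊢
      convert (add_comm (√4) (√1)).trans_le (one_add_two_le_sqrt _) using 3 <;> linarith
  refine ⟨fun hbad => ?_, hsqrt, fun KA KB KAB tA tB tAB => ?_⟩
  · rw [← hAb, ← hBb] at hbad
    rcases hcases with hmany | ⟨h3, ht, -⟩ | ⟨h3, ht, -⟩
    · omega
    · exact Or.inl ⟨h3, ht⟩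
    · exact Or.inr ⟨h3, ht⟩
  · have key : ∀ {X : Set Plane} {K : Geometry.SimplicialComplex ℝ Plane}, X.Finite →
        ¬ Collinear ℝ X → IsTriangulation X K →
        (triangleCount K : ℝ) = 2 * (interiorCount X : ℝ) + boundaryCount X - 2 := by
      intro X K hX hXc hK
      rw [eq_sub_iff_add_eq]
      exact_mod_cast triangleCount_add_two hXc hX hK
    rw [key hA hAc tA, key hB hBc tB,
      key (hA.add hB) (not_collinear_add hAc (nonempty_of_not_collinear hBc)) tAB]
    exact hsqrt
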